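/- **Setting.** The arm space is $[0,1]$. An environment consists of a (measurable) mean-payoff function $f:[0,1]\to[0,1]$ and of reward laws: when arm $X_t$ is played in round $t=1,2,\dots$, the player receives $Y_t$ which, given $X_t$, is independent of the past, has mean $f(X_t)$, and is such that $Y_t-f(X_t)$ is $(1/4)$-subgaussian, i.e. $\mathbb E[e^{\lambda (Y_t-f(X_t))}\mid X_t]\le e^{\lambda^2/8}$ for all $\lambda\in\mathbb R$. Put $M(f)=\max f$ and $\overline R_T=T\,M(f)-\mathbb E\big[\sum_{t=1}^T f(X_t)\big]$. For $\alpha,L>0$ let $\mathcal H(L,\alpha)$ be the set of $f$ for which there is $x^\star\in[0,1]$ with $f(x^\star)=M(f)$ and $|f(x^\star)-f(x)|\le L|x^\star-x|^\alpha$ for all $x\in[0,1]$. **MOSS** with horizon $n$ on $K$ arms plays in each round an arm of maximal index (the first one in case of ties), where the index of an arm that has been pulled $N\ge 1$ times with average reward $\hat\mu$ is $\hat\mu+\sqrt{\max(\ln(n/(KN)),0)/N}$, and the index of an arm not yet pulled is $+\infty$. **MeDZO** with input $B\ge 1$: let $p=\lceil\log_2 B\rceil$. For $i=1,\dots,p$,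 regime $i$ lasts $2^{p+i}$ rounds; in it a fresh copy of MOSS with horizon $2^{p+i}$ is run on $K_i+i-1$ arms, with $K_i=2^{p+2-i}$. These arms are probability measures on $[0,1]$: the uniform distributions on the $K_i$ intervals $[(k-1)/K_i,k/K_i]$, followed by the empirical distributions $\hat\nu_1,\dots,\hat\nu_{i-1}$ of the points played in each of the previous regimes. When MOSS selects a measure, $X_t$ is drawn from it and the reward $Y_t$ is given to MOSS. Rounds not covered by the regimes are played according to an arbitrary fixed law $\nu_0$ on $[0,1]$. **Doubling-trick version** with input $m\in[1/2,1]$: for $i=0,1,2,\dots$, run a fresh copy of MeDZO with input $B=2^{im}$ for $2^i$ rounds. (Only the single round of phase $i=0$, where $p=0$, is not covered by the regimes of MeDZO.) This algorithm uses neither the horizon $T$ nor $\alpha$ nor $L$. **Corollary.** Let $m\in[1/2,1]$. The doubling-trick version of MeDZO with input $m$ satisfies, for all $\alpha>0$, $L>0$ and all integers $T\ge 2$, $$\sup_{f\in\mathcal H(L,\alpha)}\overline R_T\;\le\;4000\,(\log_2 T^m)^{3/2}\max\Big(T^m,\;T\,L^{1/(\alpha+1)}(T^m)^{-\alpha/(\alpha+1)}\Big),$$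 where the supremum is over all environments with mean-payoff function $f\in\mathcal H(L,\alpha)$. For fixed $m,\alpha,L$, the right-hand side is $\mathcal O\big((\log T)^{3/2}\,T^{\theta_m(\alpha)}\big)$ as $T\to\infty$, with $\theta_m(\alpha)=\max\big(m,\,1-m\tfrac{\alpha}{\alpha+1}\big)$. -/

import Mathlib

open MeasureTheory ProbabilityTheory
open scoped ENNReal NNReal

noncomputable section

namespace MeDZO

/-! ### Finite-armed bandits: the MOSS index policy

Rounds, arms and pulls are numbered from `0`. -/

/-- The number of rounds `s < t` in which arm `k` was pulled, where `a s` is the arm of round `s`. -/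
def pullCount (a : ℕ → ℕ) (t k : ℕ) : ℕ :=
  ((Finset.range t).filter (fun s => a s = k)).card

/-- The sum of the rewards `y s` obtained from arm `k` in the rounds `s < t`. -/
def rewardSum (a : ℕ → ℕ) (y : ℕ → ℝ) (t k : ℕ) : ℝ :=
  ∑ s ∈ (Finset.range t).filter (fun s => a s = k), y s

/-- The MOSS index of arm `k` before round `t`, for horizon `n` and `K` arms: with `N` the number
of past pulls of the arm and `μ` the mean of the rewards they gave, it is
`μ + √(log₊ (n / (K N)) / N)`, and `+∞` if `N = 0`. -/
def mossIndex (n K : ℕ) (a : ℕ → ℕ) (y : ℕ → ℝ) (t k : ℕ) : EReal :=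
  if pullCount a t k = 0 then ⊤
  else ((rewardSum a y t k / (pullCount a t k : ℝ)
    + Real.sqrt (max (Real.log ((n : ℝ) / ((K : ℝ) * (pullCount a t k : ℝ)))) 0
        / (pullCount a t k : ℝ)) : ℝ) : EReal)

/-- The least element of `{0, …, K - 1}` at which `u` is maximal over this set (if `0 < K`). -/
def firstArgmax (K : ℕ) (u : ℕ → EReal) : ℕ :=
  sInf {k : ℕ | k < K ∧ ∀ j < K, u j ≤ u k}

/-- The arm, in `{0, …, K - 1}`, that MOSS with horizon `n` pulls in round `t` when `y s` is the
reward it received in round `s`, for `s < t`. -/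
def mossArm (n K : ℕ) (y : ℕ → ℝ) (t : ℕ) : ℕ :=
  firstArgmax K (mossIndex n K (fun s => if s < t then mossArm n K y s else 0) y t)
termination_by t

/-! ### Strategies on the arm space `[0, 1]`

A run is a sequence `ω : ℕ → [0, 1] × ℝ` of pairs (arm played, reward received). The law of the
arm played in round `t` is a function of the run that only reads the rounds `s < t`. -/

/-- The uniform distribution on the cell `[k / K, (k + 1) / K]` of the regular partition of
`[0, 1]` into `K` pieces. -/
def uniformCell (K k : ℕ) : Measure unitInterval :=
  cond volume {x : unitInterval | (k : ℝ) / K ≤ x ∧ (x : ℝ) ≤ ((k : ℝ) + 1) / K}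

/-- The empirical distribution of the `n` arms played in the rounds `start, …, start + n - 1`. -/
def empirical (ω : ℕ → unitInterval × ℝ) (start n : ℕ) : Measure unitInterval :=
  (n : ℝ≥0∞)⁻¹ • ∑ s ∈ Finset.range n, Measure.dirac (ω (start + s)).1

/-- The law of the arm played in round `t` by CAB1.1 with horizon `n`, the `K` measures
`π 0, …, π (K - 1)`, and MOSS as discrete algorithm. -/
def cabLaw (n K : ℕ) (π : ℕ → Measure unitInterval) (ω : ℕ → unitInterval × ℝ) (t : ℕ) :
    Measure unitInterval :=
  π (mossArm n K (fun s => (ω s).2) t)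

/-- The total length `2 ^ (p + 1) + ⋯ + 2 ^ (p + i)` of the regimes `1, …, i` of MeDZO. -/
def regimeEnd (p i : ℕ) : ℕ := ∑ j ∈ Finset.Icc 1 i, 2 ^ (p + j)

/-- The regime `i ≥ 1` that round `t` belongs to. -/
def regime (p t : ℕ) : ℕ := sInf {i : ℕ | t < regimeEnd p i}

/-- The measures available in a regime with `K` pieces: the `K` uniform distributions on the
cells, followed by the empirical distributions of the arms played in the regimes `1, 2, …`
(regime `j` comes in position `K + (j - 1)`). -/
def regimeMeasure (p K : ℕ) (ω : ℕ → unitInterval × ℝ) (k : ℕ) : Measure unitInterval :=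
  if k < K then uniformCell K k
  else empirical ω (regimeEnd p (k - K)) (2 ^ (p + (k - K + 1)))

/-- The law of the arm played in round `t` by MeDZO with input `B`: with `p = ⌈log₂ B⌉`,
regime `i = 1, …, p` lasts `2 ^ (p + i)` rounds and runs a fresh CAB1.1 with the uniform
discretization in `2 ^ (p + 2 - i)` pieces and the `i - 1` empirical distributions of the previous
regimes. Rounds after the last regime are played according to the arbitrary law `ν₀`. -/
def medzoLaw (ν₀ : Measure unitInterval) (B : ℝ) (t : ℕ) (ω : ℕ → unitInterval × ℝ) :
    Measure unitInterval :=
  let p : ℕ := ⌈Real.logb 2 B⌉₊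
  let i : ℕ := regime p t
  let start : ℕ := regimeEnd p (i - 1)
  let K : ℕ := 2 ^ (p + 2 - i)
  if i ≤ p then
    cabLaw (2 ^ (p + i)) (K + (i - 1)) (regimeMeasure p K ω) (fun s => ω (start + s)) (t - start)
  else ν₀

/-- The law of the arm played in round `t` by the doubling-trick version of MeDZO with input `m`:
phase `i = 0, 1, …` consists of the `2 ^ i` rounds `2 ^ i - 1, …, 2 ^ (i + 1) - 2`, and runs a
fresh MeDZO with input `B = 2 ^ (i m)`. -/
def anytimeLaw (m : ℝ) (ν₀ : Measure unitInterval) (t : ℕ) (ω : ℕ → unitInterval × ℝ) :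
    Measure unitInterval :=
  let i : ℕ := Nat.log 2 (t + 1)
  medzoLaw ν₀ ((2 : ℝ) ^ ((i : ℝ) * m)) (t - (2 ^ i - 1)) (fun s => ω (2 ^ i - 1 + s))

/-! ### Measurability of the strategy -/

lemma firstArgmax_lt {K : ℕ} (hK : 0 < K) (u : ℕ → EReal) : firstArgmax K u < K := by
  have hne : {k : ℕ | k < K ∧ ∀ j < K, u j ≤ u k}.Nonempty := by
    obtain ⟨k, hk, hmax⟩ := Finset.exists_max_image (Finset.range K) u ⟨0, by simpa using hK⟩
    exact ⟨k, by simpa using hk, fun j hj => hmax j (by simpa using hj)⟩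
  exact (Nat.sInf_mem hne).1

lemma measurable_sInf_nat {α : Type*} [MeasurableSpace α] {P : ℕ → α → Prop}
    (hP : ∀ k, MeasurableSet {x | P k x}) : Measurable (fun x => sInf {k | P k x}) := by
  classical
  refine measurable_to_countable' fun k => ?_
  have : (fun x => sInf {k | P k x}) ⁻¹' {k}
      = ({x | P k x} ∩ ⋂ j : Fin k, {x | P j x}ᶜ) ∪ ({x | k = 0} ∩ ⋂ j, {x | P j x}ᶜ) := by
    ext x
    simp only [Set.mem_preimage, Set.mem_singleton_iff, Set.mem_union, Set.mem_inter_iff,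
      Set.mem_ofPred_eq, Set.mem_iInter, Set.mem_compl_iff]
    constructor
    · intro h
      by_cases hne : {k | P k x}.Nonempty
      · left
        have h1 := Nat.sInf_mem hne
        rw [h] at h1
        refine ⟨h1, fun j hj => ?_⟩
        have h2 : sInf {k | P k x} ≤ j := Nat.sInf_le hj
        have := j.2
        omega
      · right
        rw [Set.not_nonempty_iff_eq_empty] at hne
        refine ⟨by rw [← h, hne, Nat.sInf_empty], fun j hj => ?_⟩
        have : j ∈ {k | P k x} := hj
        simp [hne] at this
    · rintro (⟨h1, h2⟩ | ⟨h1, h2⟩)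
      · refine le_antisymm (Nat.sInf_le h1) ?_
        by_contra hlt
        push Not at hlt
        exact h2 ⟨_, hlt⟩ (Nat.sInf_mem (s := {k | P k x}) ⟨k, h1⟩)
      · have : {k | P k x} = ∅ := by
          ext j; simpa using h2 j
        rw [this, Nat.sInf_empty, h1]
  rw [this]
  refine ((hP k).inter (MeasurableSet.iInter fun j : Fin k => (hP j).compl)).union
    ((MeasurableSet.const _).inter (MeasurableSet.iInter fun j => (hP j).compl))

lemma measurable_mossArm (n K t : ℕ) : Measurable (fun y : ℕ → ℝ => mossArm n K y t) := by
  induction t using Nat.strong_induction_on with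
  | _ t ih =>
    have ha : ∀ s, Measurable (fun y : ℕ → ℝ => if s < t then mossArm n K y s else 0) := by
      intro s
      by_cases hs : s < t
      · simpa [hs] using ih s hs
      · simp [hs]
    have hset : ∀ s k, MeasurableSet
        {y : ℕ → ℝ | (if s < t then mossArm n K y s else 0) = k} :=
      fun s k => ha s (measurableSet_singleton k)
    have hcount : ∀ k, Measurable (fun y : ℕ → ℝ =>
        pullCount (fun s => if s < t then mossArm n K y s else 0) t k) := by
      intro k
      simp only [pullCount, Finset.card_filter]
      exact Finset.measurable_sum _ fun s _ =>
        Measurable.ite (hset s k) measurable_const measurable_const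
    have hsum : ∀ k, Measurable (fun y : ℕ → ℝ =>
        rewardSum (fun s => if s < t then mossArm n K y s else 0) y t k) := by
      intro k
      simp only [rewardSum, Finset.sum_filter]
      exact Finset.measurable_sum _ fun s _ =>
        Measurable.ite (hset s k) (measurable_pi_apply s) measurable_const
    have hcountR : ∀ k, Measurable (fun y : ℕ → ℝ =>
        (pullCount (fun s => if s < t then mossArm n K y s else 0) t k : ℝ)) :=
      fun k => measurable_from_top.comp (hcount k)
    have hidx : ∀ k, Measurable (fun y : ℕ → ℝ =>
        mossIndex n K (fun s => if s < t then mossArm n K y s else 0) y t k) := by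
      intro k
      unfold mossIndex
      refine Measurable.ite (hcount k (measurableSet_singleton 0)) measurable_const ?_
      refine measurable_coe_real_ereal.comp ?_
      have h1 := hcountR k
      have h2 := hsum k
      fun_prop
    have heq : (fun y : ℕ → ℝ => mossArm n K y t) = fun y => firstArgmax K
        (mossIndex n K (fun s => if s < t then mossArm n K y s else 0) y t) := by
      funext y; rw [mossArm]
    rw [heq]
    unfold firstArgmax
    refine measurable_sInf_nat fun k => ?_
    refine (MeasurableSet.const _).inter ?_
    have : {y : ℕ → ℝ | ∀ j < K,
        mossIndex n K (fun s => if s < t then mossArm n K y s else 0) y t j ≤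
        mossIndex n K (fun s => if s < t then mossArm n K y s else 0) y t k}
        = ⋂ j, ⋂ (_ : j < K), {y : ℕ → ℝ |
        mossIndex n K (fun s => if s < t then mossArm n K y s else 0) y t j ≤
        mossIndex n K (fun s => if s < t then mossArm n K y s else 0) y t k} := by
      ext y; simp
    refine (congrArg MeasurableSet this).mpr ?_
    exact MeasurableSet.iInter fun j => MeasurableSet.iInter fun _ =>
      measurableSet_le (hidx j) (hidx k)

lemma mossArm_lt (n : ℕ) {K : ℕ} (hK : 0 < K) (y : ℕ → ℝ) (t : ℕ) : mossArm n K y t < K := by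
  rw [mossArm]; exact firstArgmax_lt hK _

lemma isProbabilityMeasure_uniformCell {K k : ℕ} (hk : k < K) :
    IsProbabilityMeasure (uniformCell K k) := by
  have hK : (0 : ℝ) < K := by exact_mod_cast (Nat.zero_le k).trans_lt hk
  refine cond_isProbabilityMeasure ?_
  have himg : Subtype.val '' {x : unitInterval | (k : ℝ) / K ≤ x ∧ (x : ℝ) ≤ ((k : ℝ) + 1) / K}
      = Set.Icc ((k : ℝ) / K) (((k : ℝ) + 1) / K) := by
    ext x
    constructor
    · rintro ⟨x, hx, rfl⟩; exact hx
    · intro hx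
      have h0 : 0 ≤ x := le_trans (by positivity) hx.1
      have h1 : x ≤ 1 := by
        refine hx.2.trans ((div_le_one hK).2 ?_)
        exact_mod_cast hk
      exact ⟨⟨x, h0, h1⟩, hx, rfl⟩
  rw [unitInterval.volume_apply, himg, Real.volume_Icc]
  have : ((k : ℝ) + 1) / K - k / K = 1 / K := by ring
  rw [this]
  simpa using (Nat.zero_le k).trans_lt hk |>.ne'

lemma isProbabilityMeasure_empirical (ω : ℕ → unitInterval × ℝ) (start : ℕ) {n : ℕ} (hn : n ≠ 0) :
    IsProbabilityMeasure (empirical ω start n) := by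
  constructor
  simp only [empirical, Measure.smul_apply, Measure.finsetSum_apply, measure_univ,
    Finset.sum_const, Finset.card_range, smul_eq_mul, nsmul_eq_mul, mul_one]
  exact ENNReal.inv_mul_cancel (by exact_mod_cast hn) (ENNReal.natCast_ne_top n)

lemma measurable_empirical (start n : ℕ) :
    Measurable (fun ω : ℕ → unitInterval × ℝ => empirical ω start n) := by
  refine Measure.measurable_of_measurable_coe _ fun s hs => ?_
  simp only [empirical, Measure.smul_apply, Measure.finsetSum_apply, smul_eq_mul]
  refine Measurable.const_mul (Finset.measurable_sum _ fun j _ => ?_) _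
  exact (Measure.measurable_coe hs).comp
    (Measure.measurable_dirac.comp (measurable_fst.comp (measurable_pi_apply (start + j))))

lemma measurable_regimeMeasure (p K k : ℕ) :
    Measurable (fun ω : ℕ → unitInterval × ℝ => regimeMeasure p K ω k) := by
  unfold regimeMeasure
  by_cases h : k < K
  · simp [h]
  · simpa [h] using measurable_empirical _ _

lemma isProbabilityMeasure_regimeMeasure (p K : ℕ) (ω : ℕ → unitInterval × ℝ) (k : ℕ) :
    IsProbabilityMeasure (regimeMeasure p K ω k) := by
  unfold regimeMeasure
  split_ifs with h
  · exact isProbabilityMeasure_uniformCell h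
  · exact isProbabilityMeasure_empirical _ _ (by positivity)

lemma measurable_medzoLaw (ν₀ : Measure unitInterval) (B : ℝ) (t : ℕ) :
    Measurable (medzoLaw ν₀ B t) := by
  unfold medzoLaw cabLaw
  dsimp only
  split_ifs with h
  · set p := ⌈Real.logb 2 B⌉₊
    set i := regime p t
    have hpair : Measurable (fun q : (ℕ → unitInterval × ℝ) × ℕ =>
        regimeMeasure p (2 ^ (p + 2 - i)) q.1 q.2) :=
      measurable_from_prod_countable_left fun k => measurable_regimeMeasure p _ k
    refine hpair.comp (measurable_id.prodMk ((measurable_mossArm _ _ _).comp ?_))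
    exact measurable_pi_lambda _ fun s => measurable_snd.comp (measurable_pi_apply _)
  · exact measurable_const

lemma isProbabilityMeasure_medzoLaw (ν₀ : Measure unitInterval) [IsProbabilityMeasure ν₀]
    (B : ℝ) (t : ℕ) (ω : ℕ → unitInterval × ℝ) : IsProbabilityMeasure (medzoLaw ν₀ B t ω) := by
  unfold medzoLaw cabLaw
  dsimp only
  split_ifs
  · exact isProbabilityMeasure_regimeMeasure _ _ _ _
  · infer_instance

lemma measurable_anytimeLaw (m : ℝ) (ν₀ : Measure unitInterval) (t : ℕ) :
    Measurable (anytimeLaw m ν₀ t) :=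
  (measurable_medzoLaw _ _ _).comp (measurable_pi_lambda _ fun _ => measurable_pi_apply _)

/-! ### Environments, interaction and regret -/

/-- A continuum-armed bandit environment: a mean-payoff function `f : [0, 1] → [0, 1]`, and for
every round `t` the law of the reward given the arm played (independently of the past), which has
mean `f x` and `1/4`-subgaussian fluctuations when the arm is `x`. -/
structure Environment where
  /-- the mean-payoff function -/
  f : unitInterval → ℝ
  measurable_f : Measurable f
  f_mem : ∀ x, f x ∈ Set.Icc (0 : ℝ) 1
  /-- the law of the reward of round `t` given the arm played -/
  reward : ℕ → Kernel unitInterval ℝ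
  isMarkov : ∀ t, IsMarkovKernel (reward t)
  mean_reward : ∀ t x, ∫ y, y ∂(reward t x) = f x
  subgaussian : ∀ t x, HasSubgaussianMGF (fun y => y - f x) (1 / 4 : ℝ≥0) (reward t x)

instance (E : Environment) (t : ℕ) : IsMarkovKernel (E.reward t) := E.isMarkov t

/-- The functions `f` on `[0, 1]` that satisfy the Hölder condition with constant `L` and exponent
`α` around one of their maxima. -/
def holderClass (L α : ℝ) : Set (unitInterval → ℝ) :=
  {f | ∃ x₀ : unitInterval, f x₀ = ⨆ x, f x ∧
    ∀ x : unitInterval, |f x₀ - f x| ≤ L * |(x₀ : ℝ) - (x : ℝ)| ^ α}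

/-- The finite history of the rounds `0, …, n`, continued by a dummy value. -/
def extend (n : ℕ) (h : (i : Finset.Iic n) → unitInterval × ℝ) : ℕ → unitInterval × ℝ :=
  fun s => if hs : s ∈ Finset.Iic n then h ⟨s, hs⟩ else (0, 0)

lemma measurable_extend (n : ℕ) : Measurable (extend n) := by
  refine measurable_pi_lambda _ fun s => ?_
  unfold extend
  by_cases hs : s ∈ Finset.Iic n
  · simpa [hs] using measurable_pi_apply _
  · simp [hs]

/-- The law of the arm of round `n + 1` given the history of the rounds `0, …, n`. -/
def armKernel (m : ℝ) (ν₀ : Measure unitInterval) (n : ℕ) :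
    Kernel ((i : Finset.Iic n) → unitInterval × ℝ) unitInterval where
  toFun h := anytimeLaw m ν₀ (n + 1) (extend n h)
  measurable' := (measurable_anytimeLaw m ν₀ (n + 1)).comp (measurable_extend n)

instance (m : ℝ) (ν₀ : Measure unitInterval) [IsProbabilityMeasure ν₀] (n : ℕ) :
    IsMarkovKernel (armKernel m ν₀ n) :=
  ⟨fun _ => isProbabilityMeasure_medzoLaw _ _ _ _⟩

/-- The law of the arm and the reward of round `n + 1` given the history. -/
def roundKernel (m : ℝ) (ν₀ : Measure unitInterval) (E : Environment) (n : ℕ) :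
    Kernel ((i : Finset.Iic n) → unitInterval × ℝ) (unitInterval × ℝ) :=
  armKernel m ν₀ n ⊗ₖ Kernel.prodMkLeft _ (E.reward (n + 1))

instance (m : ℝ) (ν₀ : Measure unitInterval) [IsProbabilityMeasure ν₀] (E : Environment) (n : ℕ) :
    IsMarkovKernel (roundKernel m ν₀ E n) := by
  unfold roundKernel; infer_instance

/-- The law of the whole run of the doubling-trick version of MeDZO with input `m` in the
environment `E`. -/
def runLaw (m : ℝ) (ν₀ : Measure unitInterval) [IsProbabilityMeasure ν₀] (E : Environment) :
    Measure (ℕ → unitInterval × ℝ) :=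
  Kernel.trajMeasure (X := fun _ => unitInterval × ℝ)
    (anytimeLaw m ν₀ 0 (fun _ => (0, 0)) ⊗ₘ E.reward 0) (roundKernel m ν₀ E)

instance (m : ℝ) (ν₀ : Measure unitInterval) [IsProbabilityMeasure ν₀] (E : Environment) :
    IsProbabilityMeasure (runLaw m ν₀ E) := by
  have : IsProbabilityMeasure (anytimeLaw m ν₀ 0 (fun _ => (0, 0))) :=
    isProbabilityMeasure_medzoLaw _ _ _ _
  unfold runLaw
  infer_instance

/-- The expected cumulative regret of the doubling-trick version of MeDZO after `T` rounds,
`T max f - 𝔼[f(X₁) + ⋯ + f(X_T)]`. -/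
def regret (m : ℝ) (ν₀ : Measure unitInterval) [IsProbabilityMeasure ν₀] (E : Environment)
    (T : ℕ) : ℝ :=
  T * (⨆ x, E.f x) - ∫ ω, ∑ t ∈ Finset.range T, E.f (ω t).1 ∂(runLaw m ν₀ E)

/-- The rate exponent `θ_m(α) = max(m, 1 - m α / (α + 1))`. -/
def rate (m α : ℝ) : ℝ := max m (1 - m * (α / (α + 1)))

end MeDZO

end

namespace MeDZO

/-! ### The MOSS policy along a fixed sequence of rewards -/

section Deterministic

/-! The engine is a distribution-free bound of order √(Kn) for MOSS against any fixed arm `j`,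
`moss_regret_le`. By optimism (`mossArm_round_le`), a round costs at most the bonus of the arm
played, its overestimation beyond a slack δ, δ itself, and the underestimation of `j` beyond its own
bonus. Bonuses telescope to order √(n/K) per arm. Both deviation terms are dominated pointwise by
weighted exponentials exp(θD - θ²N/4), where D is the deviation of a sum of N rewards. These are
supermartingales started at 1, so in expectation only the weights remain (`sum_overWeight_le`,
`sum_levelWeight_le`). Overestimations are paid once per arm and pull count, hence processes stopped
at a pull; underestimations are paid in every round, hence a peeling over dyadic pull counts with
one exponent per scale.

The arms given to MOSS are measures π with mean ∫ f dπ. Drawing the point adds a variance proxy 1/4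
(Hoeffding's lemma) to the 1/4 of the reward noise. The empirical measures are random, but frozen
when their regime starts, so that conditionally on the past they are ordinary arms
(`subgaussianRewards_regime`).

Inside a phase of level p, the number of cells times the length of a regime is always 4·4^p, so MOSS
costs about 2^p √p in each regime, while the discretization gets coarser. As long as the total
discretization error of a regime is at most 2^p, the best cell is the reference. From the first
failure on, the reference is the empirical measure of the regime just before it, of index q. Its
average regret is about 2^(-q) √p, and the failure itself forces 2^(-q) ≲ L^(1/(α+1)) 2^(-pα/(α+1))
(`inv_two_pow_le`). This is why neither α nor L has to be known.

Summing over regimes (`sum_gap_phase_le`) and then over phases (`regret_le`), the terms 2^p grow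
geometrically, the other terms are multiplied by the number of phases, and both pick up at most one
factor log₂ T^m besides the √p. -/

@[simp] lemma pullCount_zero (a : ℕ → ℕ) (k : ℕ) : pullCount a 0 k = 0 := by simp [pullCount]

@[simp] lemma rewardSum_zero (a : ℕ → ℕ) (y : ℕ → ℝ) (k : ℕ) : rewardSum a y 0 k = 0 := by
  simp [rewardSum]

lemma pullCount_succ (a : ℕ → ℕ) (t k : ℕ) :
    pullCount a (t + 1) k = pullCount a t k + if a t = k then 1 else 0 := by
  simp only [pullCount, Finset.card_filter, Finset.sum_range_succ]

lemma rewardSum_succ (a : ℕ → ℕ) (y : ℕ → ℝ) (t k : ℕ) :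
    rewardSum a y (t + 1) k = rewardSum a y t k + if a t = k then y t else 0 := by
  simp only [rewardSum, Finset.sum_filter, Finset.sum_range_succ]

lemma pullCount_le (a : ℕ → ℕ) (t k : ℕ) : pullCount a t k ≤ t := by
  simpa [pullCount] using Finset.card_filter_le (Finset.range t) (fun s => a s = k)

lemma pullCount_congr {a a' : ℕ → ℕ} {t : ℕ} (h : ∀ s < t, a s = a' s) (k : ℕ) :
    pullCount a t k = pullCount a' t k := by
  induction t with
  | zero => simp
  | succ t ih =>
    rw [pullCount_succ, pullCount_succ, ih fun s hs => h s (by omega), h t (by omega)]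

lemma rewardSum_congr {a a' : ℕ → ℕ} {y y' : ℕ → ℝ} {t : ℕ} (h : ∀ s < t, a s = a' s)
    (hy : ∀ s < t, y s = y' s) (k : ℕ) : rewardSum a y t k = rewardSum a' y' t k := by
  induction t with
  | zero => simp
  | succ t ih =>
    rw [rewardSum_succ, rewardSum_succ, ih (fun s hs => h s (by omega)) fun s hs => hy s (by omega),
      h t (by omega), hy t (by omega)]

lemma mossIndex_congr (n K : ℕ) {a a' : ℕ → ℕ} {y y' : ℕ → ℝ} {t : ℕ} (h : ∀ s < t, a s = a' s)
    (hy : ∀ s < t, y s = y' s) (k : ℕ) : mossIndex n K a y t k = mossIndex n K a' y' t k := by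
  unfold mossIndex
  rw [pullCount_congr h, rewardSum_congr h hy]

lemma mossArm_eq (n K : ℕ) (y : ℕ → ℝ) (t : ℕ) :
    mossArm n K y t = firstArgmax K (mossIndex n K (mossArm n K y) y t) := by
  rw [mossArm]
  congr 1
  funext k
  exact mossIndex_congr n K (fun s hs => by simp [hs]) (fun _ _ => rfl) k

lemma mossArm_congr (n K : ℕ) {y y' : ℕ → ℝ} (t : ℕ) (h : ∀ s < t, y s = y' s) :
    mossArm n K y t = mossArm n K y' t := by
  induction t using Nat.strong_induction_on with
  | _ t ih =>
    rw [mossArm_eq, mossArm_eq]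
    congr 1
    funext k
    exact mossIndex_congr n K (fun s hs => ih s hs fun r hr => h r (hr.trans hs)) h k

lemma le_firstArgmax {K j : ℕ} (hj : j < K) (u : ℕ → EReal) : u j ≤ u (firstArgmax K u) := by
  have hne : {k : ℕ | k < K ∧ ∀ j < K, u j ≤ u k}.Nonempty := by
    obtain ⟨k, hk, hmax⟩ := Finset.exists_max_image (Finset.range K) u ⟨j, by simpa using hj⟩
    exact ⟨k, by simpa using hk, fun j hj => hmax j (by simpa using hj)⟩
  exact (Nat.sInf_mem hne).2 j hj

lemma mossIndex_le_mossArm (n : ℕ) {K j : ℕ} (hj : j < K) (y : ℕ → ℝ) (t : ℕ) :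
    mossIndex n K (mossArm n K y) y t j
      ≤ mossIndex n K (mossArm n K y) y t (mossArm n K y t) := by
  conv_rhs => rw [mossArm_eq]
  exact le_firstArgmax hj _

/-- The exploration bonus of MOSS after `N` pulls of an arm. -/
noncomputable def bonus (n K N : ℕ) : ℝ :=
  Real.sqrt (max (Real.log ((n : ℝ) / ((K : ℝ) * (N : ℝ)))) 0 / (N : ℝ))

lemma mossIndex_of_ne_zero (n K : ℕ) {a : ℕ → ℕ} (y : ℕ → ℝ) {t k : ℕ}
    (h : pullCount a t k ≠ 0) :
    mossIndex n K a y t k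
      = ((rewardSum a y t k / pullCount a t k + bonus n K (pullCount a t k) : ℝ) : EReal) := by
  rw [mossIndex, if_neg h, bonus]

/-- Optimism: the regret of one round of MOSS with respect to a fixed arm `j` is at most the
overestimation of the arm played plus the underestimation of the arm `j`. -/
lemma mossArm_round_le (n : ℕ) {K j : ℕ} (hj : j < K) (y : ℕ → ℝ) (t : ℕ) (μ : ℕ → ℝ)
    (hμ : ∀ k < K, μ k ∈ Set.Icc (0 : ℝ) 1) {δ : ℝ} (hδ : 0 ≤ δ) :
    μ j - μ (mossArm n K y t) ≤
      (if pullCount (mossArm n K y) t (mossArm n K y t) = 0 then 1 else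
        bonus n K (pullCount (mossArm n K y) t (mossArm n K y t)) +
        max (rewardSum (mossArm n K y) y t (mossArm n K y t)
          / pullCount (mossArm n K y) t (mossArm n K y t) - μ (mossArm n K y t) - δ) 0) + δ
      + if pullCount (mossArm n K y) t j = 0 then 0 else
        max (μ j - rewardSum (mossArm n K y) y t j / pullCount (mossArm n K y) t j
          - bonus n K (pullCount (mossArm n K y) t j)) 0 := by
  have hA : mossArm n K y t < K := mossArm_lt n (by omega) y t
  have hle := mossIndex_le_mossArm n hj y t
  set A := mossArm n K y
  have hlast : 0 ≤ if pullCount A t j = 0 then (0 : ℝ) else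
        max (μ j - rewardSum A y t j / pullCount A t j
          - bonus n K (pullCount A t j)) 0 := by
    split_ifs
    · exact le_rfl
    · exact le_max_right _ _
  by_cases h0 : pullCount A t (A t) = 0
  · rw [if_pos h0]
    have h1 := (hμ j hj).2
    have h2 := (hμ _ hA).1
    linarith
  · rw [if_neg h0]
    have hj0 : pullCount A t j ≠ 0 := by
      intro hj0
      rw [mossIndex_of_ne_zero n K y h0, mossIndex, if_pos hj0] at hle
      exact EReal.coe_ne_top _ (top_le_iff.1 hle)
    rw [mossIndex_of_ne_zero n K y h0, mossIndex_of_ne_zero n K y hj0, EReal.coe_le_coe_iff] at hle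
    rw [if_neg hj0]
    have h1 := le_max_left (μ j - rewardSum A y t j / pullCount A t j
          - bonus n K (pullCount A t j)) 0
    have h2 := le_max_left (rewardSum A y t (A t) / pullCount A t (A t) - μ (A t) - δ) 0
    linarith

/-- Summing over rounds a function of the arm played and of its number of past pulls. -/
lemma sum_pullCount {M : Type*} [AddCommMonoid M] {K : ℕ} {a : ℕ → ℕ} (ha : ∀ t, a t < K) (φ : ℕ → ℕ → M)
    (τ : ℕ) : ∑ t ∈ Finset.range τ, φ (a t) (pullCount a t (a t))
      = ∑ k ∈ Finset.range K, ∑ N ∈ Finset.range (pullCount a τ k), φ k N := by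
  induction τ with
  | zero => simp
  | succ τ ih =>
    rw [Finset.sum_range_succ, ih]
    have h : ∀ k, ∑ N ∈ Finset.range (pullCount a (τ + 1) k), φ k N
        = ∑ N ∈ Finset.range (pullCount a τ k), φ k N
          + if a τ = k then φ k (pullCount a τ k) else 0 := by
      intro k
      rw [pullCount_succ]
      split_ifs with hk
      · rw [Finset.sum_range_succ]
      · simp
    simp only [h, Finset.sum_add_distrib]
    congr 1
    rw [Finset.sum_ite_eq, if_pos (Finset.mem_range.2 (ha τ))]

end Deterministic

/-! ### Numerical estimates for MOSS -/

section Numerical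

/-! ### Sum of the exploration bonuses -/

lemma log_le_sqrt {x : ℝ} (hx : 0 < x) : Real.log x ≤ Real.sqrt x := by
  -- Halving √x before using log u ≤ u - 1 gives log x ≤ √x + 2 log 2 - 2, and log 2 < 1.
  have h1 : Real.log (Real.sqrt x / 2) ≤ Real.sqrt x / 2 - 1 :=
    Real.log_le_sub_one_of_pos (by positivity)
  rw [Real.log_div (by positivity) (by norm_num), Real.log_sqrt hx.le] at h1
  have := Real.log_two_lt_d9
  linarith

/-- Since log x ≤ √x, the bonus is at most (n/K)^(1/4) N^(-3/4), which is, up to a factor 4, an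
increment of N^(1/4). The truncation at n/K reflects that the bonus vanishes beyond, and keeps the
sum bounded whatever the number of pulls. -/
lemma bonus_le_telescope {n K N : ℕ} (hK : 0 < K) (hN : 0 < N) :
    bonus n K N ≤ 4 * ((n : ℝ) / K) ^ (1 / 4 : ℝ) *
      ((min (N : ℝ) (n / K)) ^ (1 / 4 : ℝ) - (min ((N - 1 : ℕ) : ℝ) (n / K)) ^ (1 / 4 : ℝ)) := by
  have hK' : (0 : ℝ) < K := by exact_mod_cast hK
  have hN' : (0 : ℝ) < N := by exact_mod_cast hN
  set T₀ : ℝ := (n : ℝ) / K with hT₀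
  have hT0 : 0 ≤ T₀ := by positivity
  have hx : (n : ℝ) / (K * N) = T₀ / N := by rw [hT₀, div_div]
  have hN1 : ((N - 1 : ℕ) : ℝ) = N - 1 := by
    rw [Nat.cast_sub hN]; simp
  by_cases hle : (N : ℝ) ≤ T₀
  · have hTpos : 0 < T₀ := hN'.trans_le hle
    have hu : min (N : ℝ) T₀ = N := min_eq_left hle
    have hv : min ((N - 1 : ℕ) : ℝ) T₀ = N - 1 := by
      rw [hN1]; exact min_eq_left (by linarith)
    rw [hu, hv]
    have hv0 : (0 : ℝ) ≤ N - 1 := by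
      rw [← hN1]; positivity
    set u : ℝ := (N : ℝ) ^ (1 / 4 : ℝ) with hu'
    set v : ℝ := ((N : ℝ) - 1) ^ (1 / 4 : ℝ) with hv'
    set w : ℝ := T₀ ^ (1 / 4 : ℝ) with hw'
    have hu4 : u ^ 4 = N := by
      rw [hu', ← Real.rpow_natCast, ← Real.rpow_mul hN'.le]; norm_num
    have hv4 : v ^ 4 = (N : ℝ) - 1 := by
      rw [hv', ← Real.rpow_natCast, ← Real.rpow_mul hv0]; norm_num
    have hw4 : w ^ 4 = T₀ := by
      rw [hw', ← Real.rpow_natCast, ← Real.rpow_mul hT0]; norm_num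
    have hupos : 0 < u := by positivity
    have hwpos : 0 < w := by positivity
    have hvn : 0 ≤ v := by positivity
    have hvu : v ≤ u := by
      refine Real.rpow_le_rpow hv0 (by linarith) (by norm_num)
    have hlog : max (Real.log ((n : ℝ) / (K * N))) 0 ≤ w ^ 2 / u ^ 2 := by
      refine max_le ?_ (by positivity)
      rw [hx]
      refine (log_le_sqrt (by positivity)).trans (le_of_eq ?_)
      rw [← hw4, ← hu4, show w ^ 4 / u ^ 4 = (w ^ 2 / u ^ 2) ^ 2 by ring]
      exact Real.sqrt_sq (by positivity)
    have hb : bonus n K N ≤ w / u ^ 3 := by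
      unfold bonus
      refine Real.sqrt_le_iff.2 ⟨by positivity, ?_⟩
      rw [div_le_iff₀ hN']
      refine hlog.trans (le_of_eq ?_)
      rw [← hu4]
      field_simp
    refine hb.trans ?_
    rw [div_le_iff₀ (by positivity)]
    have h1 : 1 = (u - v) * (u ^ 3 + u ^ 2 * v + u * v ^ 2 + v ^ 3) := by
      have : u ^ 4 - v ^ 4 = 1 := by rw [hu4, hv4]; ring
      linarith [this]
    have h2 : u ^ 3 + u ^ 2 * v + u * v ^ 2 + v ^ 3 ≤ 4 * u ^ 3 := by
      have a1 : u ^ 2 * v ≤ u ^ 2 * u := by gcongr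
      have a2 : u * v ^ 2 ≤ u * u ^ 2 := by gcongr
      have a3 : v ^ 3 ≤ u ^ 3 := by gcongr
      nlinarith
    have h3 : 1 ≤ (u - v) * (4 * u ^ 3) := by
      rw [h1]
      exact mul_le_mul_of_nonneg_left h2 (by linarith)
    calc w = w * 1 := by ring
      _ ≤ w * ((u - v) * (4 * u ^ 3)) := by gcongr
      _ = 4 * w * (u - v) * u ^ 3 := by ring
  · push Not at hle
    have hb : bonus n K N = 0 := by
      unfold bonus
      rw [hx, max_eq_right, zero_div, Real.sqrt_zero]
      refine Real.log_nonpos (by positivity) ?_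
      rw [div_le_one hN']; exact hle.le
    rw [hb]
    have : (min ((N - 1 : ℕ) : ℝ) T₀) ^ (1 / 4 : ℝ) ≤ (min (N : ℝ) T₀) ^ (1 / 4 : ℝ) := by
      refine Real.rpow_le_rpow (le_min (by positivity) hT0) ?_ (by norm_num)
      exact min_le_min_right _ (by exact_mod_cast Nat.sub_le _ _)
    have h4 : (0 : ℝ) ≤ 4 * T₀ ^ (1 / 4 : ℝ) := by positivity
    exact mul_nonneg h4 (by linarith)

lemma sum_bonus_le {n K : ℕ} (hK : 0 < K) (m : ℕ) :
    ∑ N ∈ Finset.range m, bonus n K (N + 1) ≤ 4 * Real.sqrt ((n : ℝ) / K) := by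
  have hT0 : 0 ≤ (n : ℝ) / K := by positivity
  have h : ∀ m : ℕ, ∑ N ∈ Finset.range m, bonus n K (N + 1)
      ≤ 4 * ((n : ℝ) / K) ^ (1 / 4 : ℝ) * (min (m : ℝ) (n / K)) ^ (1 / 4 : ℝ) := by
    intro m
    induction m with
    | zero => simp; positivity
    | succ m ih =>
      rw [Finset.sum_range_succ]
      have h1 := bonus_le_telescope (n := n) hK (Nat.succ_pos m)
      simp only [Nat.succ_eq_add_one, Nat.add_sub_cancel] at h1
      linarith
  refine (h m).trans ?_
  calc 4 * ((n : ℝ) / K) ^ (1 / 4 : ℝ) * (min (m : ℝ) (n / K)) ^ (1 / 4 : ℝ)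
      ≤ 4 * ((n : ℝ) / K) ^ (1 / 4 : ℝ) * ((n : ℝ) / K) ^ (1 / 4 : ℝ) := by
        gcongr
        exact min_le_right _ _
    _ = 4 * Real.sqrt ((n : ℝ) / K) := by
        rw [Real.sqrt_eq_rpow, mul_assoc, ← Real.rpow_add_of_nonneg hT0 (by norm_num) (by norm_num)]
        norm_num

/-- The weights with which the exponential supermartingales dominate the overestimations. -/
noncomputable def overWeight (δ : ℝ) (N : ℕ) : ℝ :=
  Real.exp (-(2 * δ * Real.sqrt N)) / (2 * Real.sqrt N)

/-- The tangent inequality 1 + x ≤ e^x at x = lam·v - 1, an equality at v = 1/lam. -/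
lemma max_zero_le_exp {lam v : ℝ} (hl : 0 < lam) :
    max v 0 ≤ Real.exp (lam * v - 1) / lam := by
  refine max_le ?_ (by positivity)
  rw [le_div_iff₀ hl]
  have := Real.add_one_le_exp (lam * v - 1)
  linarith

/-- `max_zero_le_exp` with parameter 2√N. For θ = 2/√N the compensator θ²N/4 equals 1, which is
exactly the -1 in the exponent. -/
lemma overestimation_le {N : ℕ} (hN : 0 < N) (D δ : ℝ) :
    max (D / N - δ) 0 ≤ overWeight δ N *
      Real.exp (2 / Real.sqrt N * D - (2 / Real.sqrt N) ^ 2 * N / 4) := by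
  have hN' : (0 : ℝ) < N := by exact_mod_cast hN
  have hs : 0 < Real.sqrt N := Real.sqrt_pos.2 hN'
  have hsq : Real.sqrt N * Real.sqrt N = N := Real.mul_self_sqrt hN'.le
  refine (max_zero_le_exp (lam := 2 * Real.sqrt N) (by positivity)).trans (le_of_eq ?_)
  rw [overWeight, div_mul_eq_mul_div, ← Real.exp_add]
  congr 2
  set s := Real.sqrt N
  rw [← hsq]
  field_simp
  ring

/-- Comparison with the integral of e^(-2δu) over u = √N, as √N - √(N-1) ≥ 1/(2√N). -/
lemma sum_overWeight_le {δ : ℝ} (hδ : 0 < δ) (m : ℕ) :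
    ∑ N ∈ Finset.range m, overWeight δ (N + 1) ≤ 1 / (2 * δ) := by
  have h : ∀ m : ℕ, ∑ N ∈ Finset.range m, overWeight δ (N + 1)
      ≤ (1 - Real.exp (-(2 * δ * Real.sqrt m))) / (2 * δ) := by
    intro m
    induction m with
    | zero => simp
    | succ m ih =>
      rw [Finset.sum_range_succ]
      refine (add_le_add_left ih _).trans ?_
      have hmono : Real.sqrt m ≤ Real.sqrt ((m + 1 : ℕ) : ℝ) :=
        Real.sqrt_le_sqrt (by push_cast; linarith)
      have hpos : 0 < Real.sqrt ((m + 1 : ℕ) : ℝ) := Real.sqrt_pos.2 (by positivity)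
      have h1 : 1 / (2 * Real.sqrt ((m + 1 : ℕ) : ℝ))
          ≤ Real.sqrt ((m + 1 : ℕ) : ℝ) - Real.sqrt m := by
        rw [div_le_iff₀ (by positivity)]
        have a1 : Real.sqrt ((m + 1 : ℕ) : ℝ) ^ 2 = m + 1 := by
          rw [Real.sq_sqrt (by positivity)]; push_cast; ring
        have a2 : Real.sqrt (m : ℝ) ^ 2 = m := Real.sq_sqrt (by positivity)
        nlinarith [sq_nonneg (Real.sqrt ((m + 1 : ℕ) : ℝ) - Real.sqrt m)]
      unfold overWeight
      set u := Real.sqrt ((m + 1 : ℕ) : ℝ)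
      set v := Real.sqrt (m : ℝ)
      have h2 : Real.exp (-(2 * δ * v)) = Real.exp (-(2 * δ * u)) * Real.exp (2 * δ * (u - v)) := by
        rw [← Real.exp_add]; congr 1; ring
      have h3 : 2 * δ * (u - v) + 1 ≤ Real.exp (2 * δ * (u - v)) := Real.add_one_le_exp _
      have he : 0 < Real.exp (-(2 * δ * u)) := Real.exp_pos _
      have h4 : Real.exp (-(2 * δ * u)) * (2 * δ * (u - v))
          ≤ Real.exp (-(2 * δ * v)) - Real.exp (-(2 * δ * u)) := by
        rw [h2]; nlinarith
      have h5 : Real.exp (-(2 * δ * u)) / (2 * u) ≤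
          (Real.exp (-(2 * δ * v)) - Real.exp (-(2 * δ * u))) / (2 * δ) := by
        rw [le_div_iff₀ (by positivity)]
        refine le_trans ?_ h4
        calc Real.exp (-(2 * δ * u)) / (2 * u) * (2 * δ)
            = Real.exp (-(2 * δ * u)) * (2 * δ * (1 / (2 * u))) := by ring
          _ ≤ _ := by gcongr
      calc _ ≤ (1 - Real.exp (-(2 * δ * v))) / (2 * δ)
            + (Real.exp (-(2 * δ * v)) - Real.exp (-(2 * δ * u))) / (2 * δ) := by gcongr
        _ = _ := by ring
  refine (h m).trans ?_
  gcongr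
  have := Real.exp_pos (-(2 * δ * Real.sqrt m))
  linarith

/-- The log-confidence at the dyadic scale `j`. -/
noncomputable def levelLog (T₀ : ℝ) (j : ℕ) : ℝ := max (Real.log (T₀ / 2 ^ (j + 1))) 0

/-- The exponent of the supermartingale used at the dyadic scale `j`. -/
noncomputable def levelExponent (T₀ : ℝ) (j : ℕ) : ℝ :=
  Real.sqrt (1 + levelLog T₀ j) / Real.sqrt (2 ^ j)

/-- The weight of the supermartingale used at the dyadic scale `j`. -/
noncomputable def levelWeight (T₀ : ℝ) (j : ℕ) : ℝ :=
  Real.exp (-(1 / 2) - 3 / 4 * levelLog T₀ j) / Real.sqrt (2 ^ j)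

lemma levelWeight_nonneg (T₀ : ℝ) (j : ℕ) : 0 ≤ levelWeight T₀ j := by
  unfold levelWeight; positivity

/-- A single exponent c/q serves all pull counts s² of a dyadic block, on which l bounds the
log-confidence b² from below. The choice c² = 1 + l gives cb ≥ l. The resulting decay e^(-3l/4)
beats e^(-l/2), which is what later lets the weights sum to order 1/√T₀. -/
lemma max_sub_le_exp_level {l b c q s : ℝ} (D : ℝ) (hl : 0 ≤ l) (hb : 0 ≤ b) (hlb : l ≤ b ^ 2)
    (hc : 1 ≤ c) (hc2 : c ^ 2 = 1 + l) (hq : 0 < q) (hqs : q ≤ s) (hsq : s ^ 2 ≤ 2 * q ^ 2) :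
    max (D / s ^ 2 - b / s) 0 ≤ Real.exp (-(1 / 2) - 3 / 4 * l) / q *
      Real.exp (c / q * D - (c / q) ^ 2 * s ^ 2 / 4) := by
  have hs : 0 < s := hq.trans_le hqs
  refine (max_zero_le_exp (lam := c / q * s ^ 2) (by positivity)).trans ?_
  rw [div_mul_eq_mul_div (Real.exp _), ← Real.exp_add]
  have hden : q ≤ c / q * s ^ 2 := by
    rw [div_mul_eq_mul_div, le_div_iff₀ hq]
    calc q * q ≤ s * s := by gcongr
      _ = 1 * s ^ 2 := by ring
      _ ≤ c * s ^ 2 := by gcongr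
  refine div_le_div₀ (Real.exp_pos _).le (Real.exp_le_exp.2 ?_) hq hden
  -- with `β = s / q ∈ [1, √2]`, the claim is `(1 + l) β² / 4 - c β b ≤ 1 / 2 - 3 l / 4`
  obtain ⟨β, hβ⟩ : ∃ β, β = s / q := ⟨_, rfl⟩
  have hβ1 : 1 ≤ β := hβ ▸ (one_le_div hq).2 hqs
  have hβ2 : β ^ 2 ≤ 2 := by
    rw [hβ, div_pow, div_le_iff₀ (by positivity)]; exact hsq
  have e1 : c / q * s ^ 2 * (D / s ^ 2 - b / s) = c / q * D - c * β * b := by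
    rw [hβ]; field_simp
  have e2 : (c / q) ^ 2 * s ^ 2 = c ^ 2 * β ^ 2 := by rw [hβ]; ring
  rw [e1, e2, hc2]
  have h1 : l ≤ c * b := by
    have : l ^ 2 ≤ (c * b) ^ 2 := by
      rw [mul_pow, hc2, sq]
      exact mul_le_mul (by linarith) hlb hl (by linarith)
    exact le_of_sq_le_sq this (by positivity)
  have h2 : β * l ≤ c * β * b := by
    calc β * l ≤ β * (c * b) := by gcongr
      _ = c * β * b := by ring
  -- This is (β - 1)(3 - β)/4, and 1 ≤ β ≤ √2.
  have h3 : 0 ≤ -(β ^ 2 / 4 - β + 3 / 4) := by nlinarith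
  linarith [mul_nonneg hl h3]

lemma underestimation_le {n K N : ℕ} (hn : 0 < n) (hK : 0 < K) (hN : 0 < N) (D : ℝ) :
    max (D / N - bonus n K N) 0 ≤ levelWeight ((n : ℝ) / K) (Nat.log 2 N) *
      Real.exp (levelExponent ((n : ℝ) / K) (Nat.log 2 N) * D
        - levelExponent ((n : ℝ) / K) (Nat.log 2 N) ^ 2 * N / 4) := by
  have hN' : (0 : ℝ) < N := by exact_mod_cast hN
  have hK' : (0 : ℝ) < K := by exact_mod_cast hK
  have hn' : (0 : ℝ) < n := by exact_mod_cast hn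
  have hj1 : (2 : ℝ) ^ Nat.log 2 N ≤ N := by exact_mod_cast Nat.pow_log_le_self 2 hN.ne'
  have hj2 : (N : ℝ) ≤ 2 ^ (Nat.log 2 N + 1) := by
    exact_mod_cast (Nat.lt_pow_succ_log_self (by norm_num) N).le
  have hl0 : 0 ≤ levelLog ((n : ℝ) / K) (Nat.log 2 N) := le_max_right _ _
  have hlN : levelLog ((n : ℝ) / K) (Nat.log 2 N)
      ≤ max (Real.log ((n : ℝ) / (K * N))) 0 := by
    refine max_le_max_right _ (Real.log_le_log (by positivity) ?_)
    rw [div_div]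
    gcongr
  have hlN0 : 0 ≤ max (Real.log ((n : ℝ) / (K * N))) 0 := le_max_right _ _
  have h := max_sub_le_exp_level (b := Real.sqrt (max (Real.log ((n : ℝ) / (K * N))) 0))
    (c := Real.sqrt (1 + levelLog ((n : ℝ) / K) (Nat.log 2 N)))
    (q := Real.sqrt (2 ^ Nat.log 2 N)) (s := Real.sqrt N) D hl0 (Real.sqrt_nonneg _)
    (by rwa [Real.sq_sqrt hlN0]) (Real.one_le_sqrt.2 (by linarith))
    (Real.sq_sqrt (by linarith)) (Real.sqrt_pos.2 (by positivity)) (Real.sqrt_le_sqrt hj1)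
    (by rw [Real.sq_sqrt hN'.le, Real.sq_sqrt (by positivity)]; rw [pow_succ] at hj2; linarith)
  rw [Real.sq_sqrt hN'.le] at h
  unfold bonus
  rw [Real.sqrt_div hlN0]
  exact h

/-! ### Summation of the dyadic weights -/

lemma min_le_telescope {r s : ℝ} (hr : 1.18 ≤ r) (hs : 0 < s) :
    0.03 * min (1 / s ^ 2) s ≤ r * s / (1 + r * s) - s / (1 + s) := by
  have h1 : (1.18 * s) / (1 + 1.18 * s) ≤ r * s / (1 + r * s) := by
    have : 1.18 * s ≤ r * s := by gcongr
    rw [div_le_div_iff₀ (by positivity) (by nlinarith)]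
    nlinarith
  refine le_trans ?_ (sub_le_sub_right h1 _)
  rw [div_sub_div _ _ (by positivity) (by positivity), le_div_iff₀ (by positivity)]
  rcases le_total s 1 with h | h
  · calc 0.03 * min (1 / s ^ 2) s * ((1 + 1.18 * s) * (1 + s))
        ≤ 0.03 * s * ((1 + 1.18 * 1) * (1 + 1)) := by gcongr; exact min_le_right _ _
      _ ≤ _ := by nlinarith
  · calc 0.03 * min (1 / s ^ 2) s * ((1 + 1.18 * s) * (1 + s))
        ≤ 0.03 * (1 / s ^ 2) * ((s + 1.18 * s) * (s + s)) := by
          gcongr; exact min_le_left _ _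
      _ = 0.03 * (2.18 * 2) := by field_simp; norm_num
      _ ≤ 0.18 * s := by nlinarith
      _ = _ := by ring

lemma two_rpow_quarter_ge : (1.18 : ℝ) ≤ 2 ^ (1 / 4 : ℝ) := by
  have h : (1.18 : ℝ) = ((1.18 : ℝ) ^ 4) ^ (1 / 4 : ℝ) := by
    rw [← Real.rpow_natCast, ← Real.rpow_mul (by norm_num)]; norm_num
  rw [h]
  exact Real.rpow_le_rpow (by norm_num) (by norm_num) (by norm_num)

lemma exp_neg_half_mul_sqrt_two_le : Real.exp (-(1 / 2)) * Real.sqrt 2 ≤ 0.9 := by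
  have h1 : Real.exp (-(1 / 2)) * Real.sqrt 2 = Real.sqrt (2 * Real.exp (-1)) := by
    rw [Real.sqrt_mul (by norm_num), mul_comm]
    congr 1
    rw [show (-(1 / 2) : ℝ) = (-1) / 2 by norm_num, Real.exp_half]
  rw [h1]
  refine Real.sqrt_le_iff.2 ⟨by norm_num, ?_⟩
  have := Real.exp_neg_one_lt_d9
  norm_num at this ⊢
  linarith

/-- With s = (2^(j+1)/T₀)^(1/4), the weight is at most 0.9/√T₀ · min(s⁻², s): it grows geometrically
up to the scale T₀ and decays beyond. The bounded function s/(1+s) has increments of at least 0.03 ·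
min(s⁻², s) from one scale to the next, and 30 = 0.9/0.03. -/
lemma levelWeight_le_telescope {T₀ : ℝ} (hT : 0 < T₀) (j : ℕ) :
    levelWeight T₀ j ≤ 30 / Real.sqrt T₀ *
      ((2 ^ (j + 2) / T₀) ^ (1 / 4 : ℝ) / (1 + (2 ^ (j + 2) / T₀) ^ (1 / 4 : ℝ))
        - (2 ^ (j + 1) / T₀) ^ (1 / 4 : ℝ) / (1 + (2 ^ (j + 1) / T₀) ^ (1 / 4 : ℝ))) := by
  set u : ℝ := 2 ^ (j + 1) / T₀ with hu
  have hu0 : 0 < u := by positivity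
  have hu2 : 2 ^ (j + 2) / T₀ = 2 * u := by rw [hu]; ring
  rw [hu2, Real.mul_rpow (by norm_num) hu0.le]
  set s := u ^ (1 / 4 : ℝ) with hs
  have hs0 : 0 < s := by positivity
  have hs4 : s ^ 4 = u := by
    rw [hs, ← Real.rpow_natCast, ← Real.rpow_mul hu0.le]; norm_num
  have key := min_le_telescope two_rpow_quarter_ge hs0
  have hsT : Real.sqrt (2 ^ j) = s ^ 2 * Real.sqrt T₀ / Real.sqrt 2 := by
    rw [eq_div_iff (by positivity), ← Real.sqrt_mul (by positivity),
      ← Real.sqrt_sq (show 0 ≤ s ^ 2 by positivity), ← Real.sqrt_mul (by positivity)]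
    congr 1
    rw [show (s ^ 2) ^ 2 = s ^ 4 by ring, hs4, hu]
    field_simp
    ring
  have hexp : Real.exp (-(3 / 4 * levelLog T₀ j)) ≤ min 1 (s ^ 3) := by
    refine le_min (Real.exp_le_one_iff.2 ?_) ?_
    · have : 0 ≤ levelLog T₀ j := le_max_right _ _
      linarith
    · have h1 : Real.log (T₀ / 2 ^ (j + 1)) ≤ levelLog T₀ j := le_max_left _ _
      have h2 : Real.log (T₀ / 2 ^ (j + 1)) = - (4 * Real.log s) := by
        rw [← inv_div, Real.log_inv, ← hu, ← hs4, Real.log_pow]; norm_num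
      have h3 : s ^ 3 = Real.exp (3 * Real.log s) := by
        rw [mul_comm, Real.exp_mul, Real.exp_log hs0]; norm_cast
      rw [h3]
      refine Real.exp_le_exp.2 ?_
      linarith
  have h1 : levelWeight T₀ j ≤ 0.9 / Real.sqrt T₀ * min (1 / s ^ 2) s := by
    unfold levelWeight
    rw [hsT, sub_eq_add_neg, Real.exp_add]
    calc Real.exp (-(1 / 2)) * Real.exp (-(3 / 4 * levelLog T₀ j))
          / (s ^ 2 * Real.sqrt T₀ / Real.sqrt 2)
        = Real.exp (-(1 / 2)) * Real.sqrt 2 / Real.sqrt T₀ *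
          (1 / s ^ 2 * Real.exp (-(3 / 4 * levelLog T₀ j))) := by field_simp
      _ ≤ 0.9 / Real.sqrt T₀ * (1 / s ^ 2 * min 1 (s ^ 3)) := by
          gcongr; exact exp_neg_half_mul_sqrt_two_le
      _ = 0.9 / Real.sqrt T₀ * min (1 / s ^ 2) s := by
          rw [mul_min_of_nonneg _ _ (by positivity)]
          congr 2
          · ring
          · field_simp
  refine h1.trans ?_
  calc 0.9 / Real.sqrt T₀ * min (1 / s ^ 2) s
      = 30 / Real.sqrt T₀ * (0.03 * min (1 / s ^ 2) s) := by ring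
    _ ≤ _ := by gcongr

lemma sum_levelWeight_le {T₀ : ℝ} (hT : 0 < T₀) (m : ℕ) :
    ∑ j ∈ Finset.range m, levelWeight T₀ j ≤ 30 / Real.sqrt T₀ := by
  set G : ℕ → ℝ := fun j =>
    (2 ^ (j + 1) / T₀) ^ (1 / 4 : ℝ) / (1 + (2 ^ (j + 1) / T₀) ^ (1 / 4 : ℝ)) with hG
  have h0 : 0 ≤ G 0 := by rw [hG]; positivity
  have h1 : G m ≤ 1 := by
    have h2 : 0 ≤ (2 ^ (m + 1) / T₀) ^ (1 / 4 : ℝ) := by positivity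
    simp only [hG]
    rw [div_le_one (by linarith)]
    linarith
  calc ∑ j ∈ Finset.range m, levelWeight T₀ j
      ≤ ∑ j ∈ Finset.range m, 30 / Real.sqrt T₀ * (G (j + 1) - G j) :=
        Finset.sum_le_sum fun j _ => levelWeight_le_telescope hT j
    _ = 30 / Real.sqrt T₀ * (G m - G 0) := by rw [← Finset.mul_sum, Finset.sum_range_sub]
    _ ≤ 30 / Real.sqrt T₀ * 1 := by gcongr; linarith
    _ = _ := mul_one _

end Numerical

/-! ### Expected regret of MOSS under conditionally subgaussian rewards -/

section MossRegret

/-- The exponential of the recentred reward sum of arm `k`, normalized for increments that are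
`1/2`-subgaussian around `m`. -/
noncomputable def expDev (n K : ℕ) (k : ℕ) (θ : ℝ) (t : ℕ) (y : ℕ → ℝ) (m : ℝ) : ℝ :=
  Real.exp (θ * (rewardSum (mossArm n K y) y t k - pullCount (mossArm n K y) t k * m)
    - θ ^ 2 * pullCount (mossArm n K y) t k / 4)

/-! ### Exponential supermartingales of the arms -/

lemma expDev_zero (n K k : ℕ) (θ : ℝ) (y : ℕ → ℝ) (m : ℝ) : expDev n K k θ 0 y m = 1 := by
  simp [expDev]

lemma expDev_nonneg (n K k : ℕ) (θ : ℝ) (t : ℕ) (y : ℕ → ℝ) (m : ℝ) :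
    0 ≤ expDev n K k θ t y m := (Real.exp_pos _).le

lemma expDev_succ_of_ne {n K k : ℕ} (θ : ℝ) {t : ℕ} {y : ℕ → ℝ} (m : ℝ) (h : mossArm n K y t ≠ k) :
    expDev n K k θ (t + 1) y m = expDev n K k θ t y m := by
  simp [expDev, pullCount_succ, rewardSum_succ, h]

lemma expDev_succ_of_eq {n K k : ℕ} (θ : ℝ) {t : ℕ} {y : ℕ → ℝ} (m : ℝ) (h : mossArm n K y t = k) :
    expDev n K k θ (t + 1) y m
      = expDev n K k θ t y m * Real.exp (-(θ ^ 2 / 4)) * Real.exp (θ * (y t - m)) := by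
  simp only [expDev, pullCount_succ, rewardSum_succ, h, if_true, ← Real.exp_add]
  congr 1
  push_cast
  ring

lemma expDev_congr (n K k : ℕ) (θ : ℝ) {t : ℕ} {y y' : ℕ → ℝ} (h : ∀ s < t, y s = y' s) (m : ℝ) :
    expDev n K k θ t y m = expDev n K k θ t y' m := by
  have h1 : ∀ s < t, mossArm n K y s = mossArm n K y' s := fun s hs =>
    mossArm_congr n K s fun r hr => h r (hr.trans hs)
  rw [expDev, expDev, pullCount_congr h1, rewardSum_congr h1 h]

lemma measurable_pullCount_mossArm (n K t k : ℕ) :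
    Measurable (fun y : ℕ → ℝ => pullCount (mossArm n K y) t k) := by
  simp only [pullCount, Finset.card_filter]
  exact Finset.measurable_sum _ fun s _ =>
    Measurable.ite (measurable_mossArm n K s (measurableSet_singleton k))
      measurable_const measurable_const

lemma measurable_rewardSum_mossArm (n K t k : ℕ) :
    Measurable (fun y : ℕ → ℝ => rewardSum (mossArm n K y) y t k) := by
  simp only [rewardSum, Finset.sum_filter]
  exact Finset.measurable_sum _ fun s _ =>
    Measurable.ite (measurable_mossArm n K s (measurableSet_singleton k))
      (measurable_pi_apply s) measurable_const

variable {Ω : Type*} [MeasurableSpace Ω]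

lemma measurable_expDev (n K k : ℕ) (θ : ℝ) (t : ℕ) {y : ℕ → Ω → ℝ} (hy : ∀ s, Measurable (y s))
    {m : Ω → ℝ} (hm : Measurable m) :
    Measurable (fun ω => expDev n K k θ t (fun s => y s ω) (m ω)) := by
  have hY : Measurable fun ω => fun s => y s ω := measurable_pi_lambda _ hy
  have h1 : Measurable fun ω => (pullCount (mossArm n K (fun s => y s ω)) t k : ℝ) :=
    measurable_from_top.comp ((measurable_pullCount_mossArm n K t k).comp hY)
  have h2 : Measurable fun ω => rewardSum (mossArm n K (fun s => y s ω)) (fun s => y s ω) t k :=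
    (measurable_rewardSum_mossArm n K t k).comp hY
  unfold expDev
  fun_prop

/-- The function `g` only depends on the rewards of the rounds `s < t` and on the means of the
`K` arms. -/
def DependsOnPast (y μ : ℕ → Ω → ℝ) (K t : ℕ) (g : Ω → ℝ≥0∞) : Prop :=
  ∀ ω ω', (∀ s < t, y s ω = y s ω') → (∀ k < K, μ k ω = μ k ω') → g ω = g ω'

/-- In each of the rounds `t < τ`, the reward is `1/2`-subgaussian around the mean of the arm that
MOSS plays, conditionally on the past. -/
def SubgaussianRewards (P : Measure Ω) (n K τ : ℕ) (y μ : ℕ → Ω → ℝ) : Prop :=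
  ∀ t < τ, ∀ θ : ℝ, ∀ g : Ω → ℝ≥0∞, Measurable g → DependsOnPast y μ K t g →
    ∫⁻ ω, g ω * ENNReal.ofReal
        (Real.exp (θ * (y t ω - μ (mossArm n K (fun s => y s ω) t) ω))) ∂P
      ≤ ∫⁻ ω, g ω * ENNReal.ofReal (Real.exp (θ ^ 2 / 4)) ∂P

lemma integrable_and_integral_le {P : Measure Ω} {f : Ω → ℝ} (hf : Measurable f) (h0 : ∀ ω, 0 ≤ f ω)
    (h : ∫⁻ ω, ENNReal.ofReal (f ω) ∂P ≤ 1) : Integrable f P ∧ ∫ ω, f ω ∂P ≤ 1 := by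
  constructor
  · refine ⟨hf.aestronglyMeasurable, ?_⟩
    rw [hasFiniteIntegral_iff_ofReal (Filter.Eventually.of_forall h0)]
    exact h.trans_lt ENNReal.one_lt_top
  · rw [integral_eq_lintegral_of_nonneg_ae (Filter.Eventually.of_forall h0) hf.aestronglyMeasurable]
    simpa using ENNReal.toReal_mono ENNReal.one_ne_top h

variable {P : Measure Ω} [IsProbabilityMeasure P] {n K τ : ℕ} {y μ : ℕ → Ω → ℝ}

/-- The exponential process of arm `k`, stopped when the arm is pulled for the `N + 1`-st time. -/
lemma lintegral_stopped_expDev_le (hy : ∀ s, Measurable (y s)) (hμ : ∀ k < K, Measurable (μ k))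
    (hsub : SubgaussianRewards P n K τ y μ) {k : ℕ} (hk : k < K) (N : ℕ) (θ : ℝ) {t : ℕ}
    (ht : t ≤ τ) :
    ∫⁻ ω, ((if pullCount (mossArm n K (fun s => y s ω)) t k ≤ N then
          ENNReal.ofReal (expDev n K k θ t (fun s => y s ω) (μ k ω)) else 0)
        + ∑ s ∈ Finset.range t, if mossArm n K (fun s => y s ω) s = k ∧
            pullCount (mossArm n K (fun s => y s ω)) s k = N then
          ENNReal.ofReal (expDev n K k θ s (fun s => y s ω) (μ k ω)) else 0) ∂P ≤ 1 := by
  have hY : Measurable fun ω => fun s => y s ω := measurable_pi_lambda _ hy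
  have hA : ∀ s, Measurable fun ω => mossArm n K (fun s => y s ω) s :=
    fun s => (measurable_mossArm n K s).comp hY
  have hC : ∀ s, Measurable fun ω => pullCount (mossArm n K (fun s => y s ω)) s k :=
    fun s => (measurable_pullCount_mossArm n K s k).comp hY
  have hZ : ∀ s, Measurable fun ω =>
      ENNReal.ofReal (expDev n K k θ s (fun s => y s ω) (μ k ω)) :=
    fun s => (measurable_expDev n K k θ s hy (hμ k hk)).ennreal_ofReal
  induction t with
  | zero => simp [expDev_zero]
  | succ t ih =>
    refine le_trans ?_ (ih (by omega))
    set A : Ω → ℕ → ℕ := fun ω => mossArm n K (fun s => y s ω) with hAdef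
    set Z : ℕ → Ω → ℝ≥0∞ := fun s ω =>
      ENNReal.ofReal (expDev n K k θ s (fun s => y s ω) (μ k ω)) with hZdef
    -- `R` collects what the reward of round `t` does not affect: arm `k` not played, or the process
    -- stopped by now. `g` carries the rounds in which the arm is pulled while still running; its
    -- factor exp(-θ²/4) cancels the subgaussian bound, so the total does not increase.
    set R : Ω → ℝ≥0∞ := fun ω =>
      (if A ω t ≠ k ∧ pullCount (A ω) t k ≤ N then Z t ω else 0)
      + (if A ω t = k ∧ pullCount (A ω) t k = N then Z t ω else 0)
      + ∑ s ∈ Finset.range t, if A ω s = k ∧ pullCount (A ω) s k = N then Z s ω else 0 with hR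
    set g : Ω → ℝ≥0∞ := fun ω =>
      if A ω t = k ∧ pullCount (A ω) t k < N then
        Z t ω * ENNReal.ofReal (Real.exp (-(θ ^ 2 / 4))) else 0 with hg
    have mA : ∀ s, MeasurableSet {ω | A ω s = k} := fun s => hA s (measurableSet_singleton k)
    have mC : ∀ s (S : Set ℕ), MeasurableSet {ω | pullCount (A ω) s k ∈ S} :=
      fun s S => hC s (MeasurableSet.of_discrete)
    have hRm : Measurable R := by
      refine ((Measurable.ite ((mA t).compl.inter (mC t (Set.Iic N))) (hZ t)
        measurable_const).add (Measurable.ite ((mA t).inter (mC t {N})) (hZ t)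
        measurable_const)).add (Finset.measurable_sum _ fun s _ =>
          Measurable.ite ((mA s).inter (mC s {N})) (hZ s) measurable_const)
    have hgm : Measurable g :=
      Measurable.ite ((mA t).inter (mC t (Set.Iio N))) ((hZ t).mul_const _) measurable_const
    have hgp : DependsOnPast y μ K t g := by
      intro ω ω' h1 h2
      have e1 : A ω t = A ω' t := mossArm_congr n K t h1
      have e2 : pullCount (A ω) t k = pullCount (A ω') t k :=
        pullCount_congr (fun s hs => mossArm_congr n K s fun r hr => h1 r (hr.trans hs)) k
      have e3 : Z t ω = Z t ω' := by
        simp only [hZdef]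
        rw [h2 k hk, expDev_congr n K k θ h1]
      simp only [hg, e1, e2, e3]
    have hlhs : ∀ ω, ((if pullCount (A ω) (t + 1) k ≤ N then Z (t + 1) ω else 0)
        + ∑ s ∈ Finset.range (t + 1), if A ω s = k ∧ pullCount (A ω) s k = N then Z s ω else 0)
        = R ω + g ω * ENNReal.ofReal (Real.exp (θ * (y t ω - μ (A ω t) ω))) := by
      intro ω
      rw [Finset.sum_range_succ, pullCount_succ]
      by_cases hAk : A ω t = k
      · have hZs : Z (t + 1) ω = Z t ω * ENNReal.ofReal (Real.exp (-(θ ^ 2 / 4)))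
            * ENNReal.ofReal (Real.exp (θ * (y t ω - μ k ω))) := by
          simp only [hZdef]
          rw [expDev_succ_of_eq θ _ hAk, ENNReal.ofReal_mul (by
            have := expDev_nonneg n K k θ t (fun s => y s ω) (μ k ω); positivity),
            ENNReal.ofReal_mul (expDev_nonneg _ _ _ _ _ _ _)]
        simp only [hR, hg, hAk, ne_eq, not_true_eq_false, false_and, if_false, true_and, if_true,
          zero_add]
        rcases lt_trichotomy (pullCount (A ω) t k) N with h | h | h
        · rw [if_pos (by omega), if_neg (by omega), if_pos h, hZs]
          simp only [add_zero, zero_add]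
          ring
        · rw [if_neg (by omega), if_pos h, if_neg (by omega)]
          ring
        · rw [if_neg (by omega), if_neg (by omega), if_neg (by omega)]
          ring
      · have hZs : Z (t + 1) ω = Z t ω := by
          simp only [hZdef]
          rw [expDev_succ_of_ne θ _ hAk]
        simp only [hR, hg, hAk, hZs, ne_eq, not_false_eq_true, true_and, false_and, if_false,
          add_zero, zero_mul]
    have hrhs : ∀ ω, R ω + g ω * ENNReal.ofReal (Real.exp (θ ^ 2 / 4))
        = ((if pullCount (A ω) t k ≤ N then Z t ω else 0)
        + ∑ s ∈ Finset.range t, if A ω s = k ∧ pullCount (A ω) s k = N then Z s ω else 0) := by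
      intro ω
      have hc : ENNReal.ofReal (Real.exp (-(θ ^ 2 / 4))) * ENNReal.ofReal (Real.exp (θ ^ 2 / 4))
          = 1 := by
        rw [← ENNReal.ofReal_mul (Real.exp_pos _).le, ← Real.exp_add]; simp
      by_cases hAk : A ω t = k
      · simp only [hR, hg, hAk, ne_eq, not_true_eq_false, false_and, if_false, true_and, zero_add]
        rcases lt_trichotomy (pullCount (A ω) t k) N with h | h | h
        · rw [if_pos h.le, if_neg (by omega), if_pos h, mul_assoc, hc]
          ring
        · rw [if_pos h, if_neg (by omega), if_pos h.le]
          ring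
        · rw [if_neg (by omega), if_neg (by omega), if_neg (by omega)]
          ring
      · simp only [hR, hg, hAk, ne_eq, not_false_eq_true, true_and, false_and, if_false,
          add_zero, zero_mul]
    rw [lintegral_congr hlhs, ← lintegral_congr hrhs, lintegral_add_left hRm,
      lintegral_add_left hRm]
    exact add_le_add le_rfl (hsub t (by omega) θ g hgm hgp)

/-- With N = t the process is not stopped before round t, since an arm has at most t past pulls. -/
lemma integral_expDev_le (hy : ∀ s, Measurable (y s)) (hμ : ∀ k < K, Measurable (μ k))
    (hsub : SubgaussianRewards P n K τ y μ) {k : ℕ} (hk : k < K) (θ : ℝ) {t : ℕ} (ht : t ≤ τ) :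
    Integrable (fun ω => expDev n K k θ t (fun s => y s ω) (μ k ω)) P ∧
      ∫ ω, expDev n K k θ t (fun s => y s ω) (μ k ω) ∂P ≤ 1 := by
  refine integrable_and_integral_le (measurable_expDev n K k θ t hy (hμ k hk))
    (fun ω => expDev_nonneg _ _ _ _ _ _ _) ?_
  refine le_trans (lintegral_mono fun ω => ?_) (lintegral_stopped_expDev_le hy hμ hsub hk t θ ht)
  rw [if_pos (pullCount_le _ _ _)]
  exact le_self_add

/-- The value of the exponential process of arm `k` at the time when the arm is pulled for the
`N + 1`-st time, if this happens before `τ`. -/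
noncomputable def pullExpDev (n K τ k N : ℕ) (θ : ℝ) (y : ℕ → ℝ) (m : ℝ) : ℝ :=
  ∑ s ∈ Finset.range τ, if mossArm n K y s = k ∧ pullCount (mossArm n K y) s k = N then
    expDev n K k θ s y m else 0

lemma integral_pullExpDev_le (hy : ∀ s, Measurable (y s)) (hμ : ∀ k < K, Measurable (μ k))
    (hsub : SubgaussianRewards P n K τ y μ) {k : ℕ} (hk : k < K) (N : ℕ) (θ : ℝ) :
    Integrable (fun ω => pullExpDev n K τ k N θ (fun s => y s ω) (μ k ω)) P ∧
      ∫ ω, pullExpDev n K τ k N θ (fun s => y s ω) (μ k ω) ∂P ≤ 1 := by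
  have hY : Measurable fun ω => fun s => y s ω := measurable_pi_lambda _ hy
  have h0 : ∀ (s : ℕ) (ω : Ω), 0 ≤ if mossArm n K (fun s => y s ω) s = k ∧
      pullCount (mossArm n K (fun s => y s ω)) s k = N then
      expDev n K k θ s (fun s => y s ω) (μ k ω) else 0 := by
    intro s ω
    split_ifs
    · exact expDev_nonneg _ _ _ _ _ _ _
    · exact le_rfl
  unfold pullExpDev
  refine integrable_and_integral_le ?_ (fun ω => Finset.sum_nonneg fun s _ => h0 s ω) ?_
  · refine Finset.measurable_sum _ fun s _ => Measurable.ite ?_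
      (measurable_expDev n K k θ s hy (hμ k hk)) measurable_const
    exact (((measurable_mossArm n K s).comp hY) (measurableSet_singleton k)).inter
      (((measurable_pullCount_mossArm n K s k).comp hY) (measurableSet_singleton N))
  · refine le_trans (lintegral_mono fun ω => ?_)
      (lintegral_stopped_expDev_le hy hμ hsub hk N θ le_rfl)
    refine le_trans (le_of_eq ?_) le_add_self
    rw [ENNReal.ofReal_sum_of_nonneg fun s _ => h0 s ω]
    refine Finset.sum_congr rfl fun s _ => ?_
    split_ifs <;> simp

/-- Pathwise bound on the regret of MOSS with respect to a fixed arm. -/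
lemma sum_mossArm_le (hK : 0 < K) (hn : 0 < n) (hτ : τ ≤ n) {j : ℕ} (hj : j < K) (y μ : ℕ → ℝ)
    (hμ : ∀ k < K, μ k ∈ Set.Icc (0 : ℝ) 1) {δ : ℝ} (hδ : 0 ≤ δ) :
    ∑ t ∈ Finset.range τ, (μ j - μ (mossArm n K y t)) ≤
      K * (1 + 4 * Real.sqrt ((n : ℝ) / K)) + n * δ
      + ∑ k ∈ Finset.range K, ∑ N ∈ Finset.range n, overWeight δ (N + 1)
          * pullExpDev n K τ k (N + 1) (2 / Real.sqrt ((N + 1 : ℕ) : ℝ)) y (μ k)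
      + ∑ t ∈ Finset.range τ, ∑ i ∈ Finset.range n, levelWeight ((n : ℝ) / K) i
          * expDev n K j (-levelExponent ((n : ℝ) / K) i) t y (μ j) := by
  set A := mossArm n K y with hA
  have hAlt : ∀ t, A t < K := fun t => mossArm_lt n hK y t
  -- The first pull of an arm, forced by its infinite index, is charged 1.
  set φ : ℕ → ℕ → ℝ := fun k N => if N = 0 then 1 else bonus n K N with hφ
  set ψ : ℕ → ℕ → ℕ → ℝ := fun t k N => if A t = k ∧ pullCount A t k = N + 1 then
    overWeight δ (N + 1) * expDev n K k (2 / Real.sqrt ((N + 1 : ℕ) : ℝ)) t y (μ k) else 0 with hψ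
  have hψ0 : ∀ t k N, 0 ≤ ψ t k N := by
    intro t k N
    simp only [hψ]
    split_ifs
    · exact mul_nonneg (by unfold overWeight; positivity) (expDev_nonneg _ _ _ _ _ _ _)
    · exact le_rfl
  have hround : ∀ t ∈ Finset.range τ, μ j - μ (A t) ≤ φ (A t) (pullCount A t (A t)) + δ
      + ∑ k ∈ Finset.range K, ∑ N ∈ Finset.range n, ψ t k N
      + ∑ i ∈ Finset.range n, levelWeight ((n : ℝ) / K) i
          * expDev n K j (-levelExponent ((n : ℝ) / K) i) t y (μ j) := by
    intro t ht
    have htn : t < n := (Finset.mem_range.1 ht).trans_le hτ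
    refine (mossArm_round_le n hj y t μ hμ hδ).trans ?_
    rw [← hA]
    have hover : (if pullCount A t (A t) = 0 then 1 else bonus n K (pullCount A t (A t)) +
        max (rewardSum A y t (A t) / pullCount A t (A t) - μ (A t) - δ) 0)
        ≤ φ (A t) (pullCount A t (A t)) + ∑ k ∈ Finset.range K, ∑ N ∈ Finset.range n, ψ t k N := by
      have hs0 : 0 ≤ ∑ k ∈ Finset.range K, ∑ N ∈ Finset.range n, ψ t k N :=
        Finset.sum_nonneg fun k _ => Finset.sum_nonneg fun N _ => hψ0 t k N
      by_cases h0 : pullCount A t (A t) = 0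
      · simp only [hφ, h0, if_true]; linarith
      · simp only [hφ, h0, if_false]
        refine (add_le_add_iff_left _).2 ?_
        obtain ⟨N, hN⟩ := Nat.exists_eq_succ_of_ne_zero h0
        have hNn : N < n := by
          have := pullCount_le A t (A t); omega
        -- The overestimation is dominated by the term of the arm played and of its current pull
        -- count; all other terms are nonnegative.
        have h1 : ψ t (A t) N ≤ ∑ k ∈ Finset.range K, ∑ N ∈ Finset.range n, ψ t k N :=
          (Finset.single_le_sum (f := fun N => ψ t (A t) N) (fun N _ => hψ0 t _ N)
            (Finset.mem_range.2 hNn)).trans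
          (Finset.single_le_sum (f := fun k => ∑ N ∈ Finset.range n, ψ t k N)
            (fun k _ => Finset.sum_nonneg fun N _ => hψ0 t k N) (Finset.mem_range.2 (hAlt t)))
        refine le_trans ?_ h1
        simp only [hψ]
        rw [if_pos ⟨trivial, hN⟩, expDev, ← hA, hN, ← Nat.succ_eq_add_one]
        have h2 := overestimation_le (Nat.succ_pos N)
          (rewardSum A y t (A t) - (N.succ : ℕ) * μ (A t)) δ
        refine le_trans (le_of_eq ?_) h2
        congr 2
        field_simp
    have hunder : (if pullCount A t j = 0 then 0 else
        max (μ j - rewardSum A y t j / pullCount A t j - bonus n K (pullCount A t j)) 0)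
        ≤ ∑ i ∈ Finset.range n, levelWeight ((n : ℝ) / K) i
          * expDev n K j (-levelExponent ((n : ℝ) / K) i) t y (μ j) := by
      have hw0 : ∀ i ∈ Finset.range n, 0 ≤ levelWeight ((n : ℝ) / K) i
          * expDev n K j (-levelExponent ((n : ℝ) / K) i) t y (μ j) :=
        fun i _ => mul_nonneg (levelWeight_nonneg _ _) (expDev_nonneg _ _ _ _ _ _ _)
      split_ifs with h0
      · exact Finset.sum_nonneg hw0
      · have hpos : 0 < pullCount A t j := Nat.pos_of_ne_zero h0
        -- Summing over n scales is crude but free: the total weight is bounded independently of the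
        -- number of scales.
        have hlog : Nat.log 2 (pullCount A t j) < n :=
          ((Nat.log_le_self 2 _).trans (pullCount_le A t j)).trans_lt htn
        refine le_trans ?_ (Finset.single_le_sum hw0 (Finset.mem_range.2 hlog))
        have h2 := underestimation_le hn hK hpos
          (pullCount A t j * μ j - rewardSum A y t j)
        rw [expDev, ← hA]
        have hne : (pullCount A t j : ℝ) ≠ 0 := by exact_mod_cast h0
        refine le_trans (le_of_eq ?_) (h2.trans (le_of_eq ?_))
        · congr 2
          field_simp
        · congr 2
          ring
    linarith
  refine (Finset.sum_le_sum hround).trans ?_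
  rw [Finset.sum_add_distrib, Finset.sum_add_distrib, Finset.sum_add_distrib]
  gcongr ?_ + ?_ + ?_ + _
  · rw [sum_pullCount hAlt φ τ]
    calc ∑ k ∈ Finset.range K, ∑ N ∈ Finset.range (pullCount A τ k), φ k N
        ≤ ∑ k ∈ Finset.range K, (1 + 4 * Real.sqrt ((n : ℝ) / K)) := by
          refine Finset.sum_le_sum fun k _ => ?_
          cases pullCount A τ k with
          | zero => simp; positivity
          | succ m =>
            rw [Finset.sum_range_succ', add_comm]
            simp only [hφ, if_true, Nat.add_eq_zero_iff, one_ne_zero, and_false, if_false]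
            gcongr
            exact sum_bonus_le hK m
      _ = _ := by rw [Finset.sum_const, Finset.card_range, nsmul_eq_mul]
  · rw [Finset.sum_const, Finset.card_range, nsmul_eq_mul]
    gcongr
  -- Exchanging the sums regroups the terms by arm and pull count, which turns the sum over rounds
  -- into the stopped value.
  · refine le_of_eq ?_
    rw [Finset.sum_comm]
    refine Finset.sum_congr rfl fun k _ => ?_
    rw [Finset.sum_comm]
    refine Finset.sum_congr rfl fun N _ => ?_
    rw [pullExpDev, Finset.mul_sum]
    refine Finset.sum_congr rfl fun t _ => ?_
    simp only [hψ, ← hA]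
    split_ifs <;> simp

lemma measurable_mean_mossArm (hK : 0 < K) (hy : ∀ s, Measurable (y s))
    (hμ : ∀ k < K, Measurable (μ k)) (t : ℕ) :
    Measurable fun ω => μ (mossArm n K (fun s => y s ω) t) ω := by
  have hY : Measurable fun ω => fun s => y s ω := measurable_pi_lambda _ hy
  have h : (fun ω => μ (mossArm n K (fun s => y s ω) t) ω) = fun ω =>
      ∑ k ∈ Finset.range K, if mossArm n K (fun s => y s ω) t = k then μ k ω else 0 := by
    funext ω
    rw [Finset.sum_ite_eq, if_pos (Finset.mem_range.2 (mossArm_lt n hK _ t))]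
  rw [h]
  exact Finset.measurable_sum _ fun k hk => Measurable.ite
    (((measurable_mossArm n K t).comp hY) (measurableSet_singleton k))
    (hμ k (Finset.mem_range.1 hk)) measurable_const

/-- Distribution-free bound on the expected regret of MOSS with respect to a fixed arm. -/
theorem moss_regret_le (hK : 0 < K) (hKn : K ≤ n) (hτ : τ ≤ n) (hy : ∀ s, Measurable (y s))
    (hμ : ∀ k < K, Measurable (μ k)) (hμ01 : ∀ k < K, ∀ ω, μ k ω ∈ Set.Icc (0 : ℝ) 1)
    (hsub : SubgaussianRewards P n K τ y μ) {j : ℕ} (hj : j < K) :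
    ∫ ω, ∑ t ∈ Finset.range τ, (μ j ω - μ (mossArm n K (fun s => y s ω) t) ω) ∂P
      ≤ 40 * Real.sqrt (K * n) := by
  have hn : 0 < n := hK.trans_le hKn
  have hK' : (0 : ℝ) < K := by exact_mod_cast hK
  have hn' : (0 : ℝ) < n := by exact_mod_cast hn
  -- This δ makes both the slack nδ and the overestimations K/(2δ) of order √(Kn).
  set δ : ℝ := Real.sqrt (K / n) with hδ
  have hδ0 : 0 < δ := Real.sqrt_pos.2 (by positivity)
  have hIp := fun k (hk : k < K) N => integral_pullExpDev_le hy hμ hsub hk (N + 1)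
    (2 / Real.sqrt ((N + 1 : ℕ) : ℝ))
  have hIe := fun t (ht : t < τ) i =>
    integral_expDev_le hy hμ hsub hj (-levelExponent ((n : ℝ) / K) i) ht.le
  have hint1 : Integrable (fun ω => ∑ k ∈ Finset.range K, ∑ N ∈ Finset.range n,
      overWeight δ (N + 1) * pullExpDev n K τ k (N + 1) (2 / Real.sqrt ((N + 1 : ℕ) : ℝ))
        (fun s => y s ω) (μ k ω)) P :=
    integrable_finsetSum _ fun k hk => integrable_finsetSum _ fun N _ =>
      (hIp k (Finset.mem_range.1 hk) N).1.const_mul _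
  have hint2 : Integrable (fun ω => ∑ t ∈ Finset.range τ, ∑ i ∈ Finset.range n,
      levelWeight ((n : ℝ) / K) i
        * expDev n K j (-levelExponent ((n : ℝ) / K) i) t (fun s => y s ω) (μ j ω)) P :=
    integrable_finsetSum _ fun t ht => integrable_finsetSum _ fun i _ =>
      (hIe t (Finset.mem_range.1 ht) i).1.const_mul _
  have hint0 : Integrable (fun ω => ∑ t ∈ Finset.range τ,
      (μ j ω - μ (mossArm n K (fun s => y s ω) t) ω)) P := by
    refine integrable_finsetSum _ fun t _ => Integrable.sub ?_ ?_
    · exact Integrable.of_mem_Icc 0 1 (hμ j hj).aemeasurable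
        (Filter.Eventually.of_forall fun ω => hμ01 j hj ω)
    · exact Integrable.of_mem_Icc 0 1 (measurable_mean_mossArm hK hy hμ t).aemeasurable
        (Filter.Eventually.of_forall fun ω => hμ01 _ (mossArm_lt n hK _ t) ω)
  have how : ∀ N, 0 ≤ overWeight δ N := fun N => by unfold overWeight; positivity
  have hb1 : ∫ ω, ∑ k ∈ Finset.range K, ∑ N ∈ Finset.range n,
      overWeight δ (N + 1) * pullExpDev n K τ k (N + 1) (2 / Real.sqrt ((N + 1 : ℕ) : ℝ))
        (fun s => y s ω) (μ k ω) ∂P ≤ K * (1 / (2 * δ)) := by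
    rw [integral_finsetSum _ fun k hk => integrable_finsetSum _ fun N _ =>
      (hIp k (Finset.mem_range.1 hk) N).1.const_mul _]
    calc _ ≤ ∑ k ∈ Finset.range K, 1 / (2 * δ) := by
          refine Finset.sum_le_sum fun k hk => ?_
          rw [integral_finsetSum _ fun N _ => (hIp k (Finset.mem_range.1 hk) N).1.const_mul _]
          refine le_trans (Finset.sum_le_sum fun N _ => ?_) (sum_overWeight_le hδ0 n)
          rw [integral_const_mul]
          exact mul_le_of_le_one_right (how _) (hIp k (Finset.mem_range.1 hk) N).2
      _ = _ := by simp
  have hb2 : ∫ ω, ∑ t ∈ Finset.range τ, ∑ i ∈ Finset.range n,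
      levelWeight ((n : ℝ) / K) i
        * expDev n K j (-levelExponent ((n : ℝ) / K) i) t (fun s => y s ω) (μ j ω) ∂P
      ≤ n * (30 / Real.sqrt (n / K)) := by
    rw [integral_finsetSum _ fun t ht => integrable_finsetSum _ fun i _ =>
      (hIe t (Finset.mem_range.1 ht) i).1.const_mul _]
    calc _ ≤ ∑ t ∈ Finset.range τ, 30 / Real.sqrt ((n : ℝ) / K) := by
          refine Finset.sum_le_sum fun t ht => ?_
          rw [integral_finsetSum _ fun i _ => (hIe t (Finset.mem_range.1 ht) i).1.const_mul _]
          refine le_trans (Finset.sum_le_sum fun i _ => ?_)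
            (sum_levelWeight_le (T₀ := (n : ℝ) / K) (by positivity) n)
          rw [integral_const_mul]
          exact mul_le_of_le_one_right (levelWeight_nonneg _ _) (hIe t (Finset.mem_range.1 ht) i).2
      _ = τ * (30 / Real.sqrt (n / K)) := by simp
      _ ≤ _ := by gcongr
  have hmain : ∫ ω, ∑ t ∈ Finset.range τ, (μ j ω - μ (mossArm n K (fun s => y s ω) t) ω) ∂P
      ≤ K * (1 + 4 * Real.sqrt ((n : ℝ) / K)) + n * δ + K * (1 / (2 * δ))
        + n * (30 / Real.sqrt (n / K)) := by
    refine (integral_mono hint0 (((integrable_const _).add hint1).add hint2) fun ω =>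
      sum_mossArm_le hK hn hτ hj (fun s => y s ω) (fun k => μ k ω)
        (fun k hk => hμ01 k hk ω) hδ0.le).trans ?_
    rw [integral_add' ((integrable_const _).add hint1) hint2, integral_add' (integrable_const _) hint1,
      integral_const, probReal_univ, one_smul]
    gcongr
  refine hmain.trans ?_
  set a := Real.sqrt (K : ℝ)
  set b := Real.sqrt (n : ℝ)
  have ha : 0 < a := Real.sqrt_pos.2 hK'
  have hb : 0 < b := Real.sqrt_pos.2 hn'
  have hab : a ≤ b := Real.sqrt_le_sqrt (by exact_mod_cast hKn)
  have ha2 : (K : ℝ) = a ^ 2 := (Real.sq_sqrt hK'.le).symm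
  have hb2 : (n : ℝ) = b ^ 2 := (Real.sq_sqrt hn'.le).symm
  rw [hδ, Real.sqrt_div hK'.le, Real.sqrt_div hn'.le, Real.sqrt_mul hK'.le]
  change K * (1 + 4 * (b / a)) + n * (a / b) + K * (1 / (2 * (a / b))) + n * (30 / (b / a))
    ≤ 40 * (a * b)
  rw [ha2, hb2]
  -- 35.5 = 4 + 1 + 1/2 + 30 (bonuses, slack, overestimations, underestimations); the leftover K is
  -- absorbed through K ≤ n.
  have e : a ^ 2 * (1 + 4 * (b / a)) + b ^ 2 * (a / b) + a ^ 2 * (1 / (2 * (a / b)))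
      + b ^ 2 * (30 / (b / a)) = a ^ 2 + 35.5 * (a * b) := by
    field_simp
    ring
  rw [e]
  nlinarith

end MossRegret

/-! ### Rounds, regimes and phases -/

section Regimes

lemma regimeEnd_zero (p : ℕ) : regimeEnd p 0 = 0 := by simp [regimeEnd]

lemma regimeEnd_succ (p i : ℕ) : regimeEnd p (i + 1) = regimeEnd p i + 2 ^ (p + (i + 1)) := by
  unfold regimeEnd
  rw [Finset.sum_Icc_succ_top (by omega)]

lemma regimeEnd_mono (p : ℕ) : Monotone (regimeEnd p) :=
  monotone_nat_of_le_succ fun i => by rw [regimeEnd_succ]; exact Nat.le_add_right _ _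

lemma regime_eq {p i t : ℕ} (ht : t < 2 ^ (p + (i + 1))) :
    regime p (regimeEnd p i + t) = i + 1 := by
  unfold regime
  refine le_antisymm (Nat.sInf_le ?_) ?_
  · change regimeEnd p i + t < regimeEnd p (i + 1)
    rw [regimeEnd_succ]; omega
  · refine le_csInf ⟨i + 1, ?_⟩ fun j hj => ?_
    · change regimeEnd p i + t < regimeEnd p (i + 1)
      rw [regimeEnd_succ]; omega
    · by_contra h
      have h1 : regimeEnd p j ≤ regimeEnd p i := regimeEnd_mono p (by omega)
      have h2 : regimeEnd p i + t < regimeEnd p j := hj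
      omega

/-- The value of the parameter `p` of MeDZO in the phase `i` of the doubling trick. -/
noncomputable def phaseLevel (m : ℝ) (i : ℕ) : ℕ := ⌈(i : ℝ) * m⌉₊

/-- The first round of the regime `r + 1` of the phase `i`. -/
noncomputable def regimeStart (m : ℝ) (i r : ℕ) : ℕ := 2 ^ i - 1 + regimeEnd (phaseLevel m i) r

/-- The number of cells in the regime `r + 1` of the phase `i`. -/
noncomputable def cells (m : ℝ) (i r : ℕ) : ℕ := 2 ^ (phaseLevel m i + 1 - r)

/-- The `k`-th measure available in the regime `r + 1` of the phase `i`. -/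
noncomputable def phaseMeasure (m : ℝ) (i r : ℕ) (ω : ℕ → unitInterval × ℝ) (k : ℕ) :
    Measure unitInterval :=
  regimeMeasure (phaseLevel m i) (cells m i r) (fun s => ω (2 ^ i - 1 + s)) k

/-- Inside a regime the strategy is MOSS fed with the rewards of that regime alone, acting on
measures; `hti` keeps the round within phase `i`. -/
lemma anytimeLaw_regime {m : ℝ} (ν₀ : Measure unitInterval) {i r t : ℕ} (hr : r < phaseLevel m i)
    (ht : t < 2 ^ (phaseLevel m i + (r + 1))) (hti : regimeEnd (phaseLevel m i) r + t < 2 ^ i)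
    (ω : ℕ → unitInterval × ℝ) :
    anytimeLaw m ν₀ (regimeStart m i r + t) ω = phaseMeasure m i r ω
      (mossArm (2 ^ (phaseLevel m i + (r + 1))) (cells m i r + r)
        (fun s => (ω (regimeStart m i r + s)).2) t) := by
  have h2 : 1 ≤ 2 ^ i := Nat.one_le_two_pow
  have hlog : Nat.log 2 (regimeStart m i r + t + 1) = i := by
    rw [Nat.log_eq_iff (Or.inr ⟨by norm_num, by omega⟩), pow_succ]
    unfold regimeStart
    omega
  have hB : ⌈Real.logb 2 ((2 : ℝ) ^ ((i : ℝ) * m))⌉₊ = phaseLevel m i := by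
    rw [Real.logb_rpow (by norm_num) (by norm_num), phaseLevel]
  have hsub : regimeStart m i r + t - (2 ^ i - 1) = regimeEnd (phaseLevel m i) r + t := by
    unfold regimeStart; omega
  have hK : phaseLevel m i + 2 - (r + 1) = phaseLevel m i + 1 - r := by omega
  simp only [anytimeLaw, hlog, medzoLaw, hB, hsub, regime_eq ht, cabLaw, Nat.add_sub_cancel,
    Nat.add_sub_cancel_left, hK]
  rw [if_pos (by omega)]
  simp only [phaseMeasure, cells, regimeStart, add_assoc]

/-- An empirical measure available in a regime only reads strictly earlier regimes, so all the
measures are frozen when the regime starts. -/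
lemma phaseMeasure_congr {m : ℝ} {i r k : ℕ} (hk : k < cells m i r + r) {ω ω' : ℕ → unitInterval × ℝ}
    (h : ∀ s < regimeStart m i r, ω s = ω' s) : phaseMeasure m i r ω k = phaseMeasure m i r ω' k := by
  unfold phaseMeasure regimeMeasure
  split_ifs with h1
  · rfl
  · unfold empirical
    congr 1
    refine Finset.sum_congr rfl fun s hs => ?_
    have h2 : regimeEnd (phaseLevel m i) (k - cells m i r + 1) ≤ regimeEnd (phaseLevel m i) r :=
      regimeEnd_mono _ (by omega)
    rw [regimeEnd_succ] at h2
    have h3 := Finset.mem_range.1 hs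
    have h4 := h (2 ^ i - 1 + (regimeEnd (phaseLevel m i) (k - cells m i r) + s))
      (by unfold regimeStart; omega)
    dsimp only
    rw [h4]

lemma cells_pos (m : ℝ) (i r : ℕ) : 0 < cells m i r := by unfold cells; positivity

lemma anytimeLaw_congr_regime {m : ℝ} (ν₀ : Measure unitInterval) {i r t : ℕ}
    (hr : r < phaseLevel m i) (ht : t < 2 ^ (phaseLevel m i + (r + 1)))
    (hti : regimeEnd (phaseLevel m i) r + t < 2 ^ i) {ω ω' : ℕ → unitInterval × ℝ}
    (h : ∀ s < regimeStart m i r + t, ω s = ω' s) :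
    anytimeLaw m ν₀ (regimeStart m i r + t) ω = anytimeLaw m ν₀ (regimeStart m i r + t) ω' := by
  rw [anytimeLaw_regime ν₀ hr ht hti, anytimeLaw_regime ν₀ hr ht hti]
  rw [mossArm_congr _ _ t fun s hs => congrArg Prod.snd (h (regimeStart m i r + s) (by omega))]
  exact phaseMeasure_congr (mossArm_lt _ (by have := cells_pos m i r; omega) _ _)
    fun s hs => h s (by omega)

end Regimes

/-! ### Conditional laws along a run -/

section RunLaw

variable (m : ℝ) (ν₀ : Measure unitInterval) [IsProbabilityMeasure ν₀] (E : Environment)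

lemma extend_frestrictLe (n : ℕ) (ω : ℕ → unitInterval × ℝ) {s : ℕ} (hs : s ≤ n) :
    extend n (Preorder.frestrictLe (π := fun _ => unitInterval × ℝ) n ω) s = ω s := by
  simp [extend, hs]

/-- One-step disintegration of the run. It is phrased with functionals of whole runs that only read
the past, so that finite histories and their dummy continuation do not appear afterwards. -/
lemma lintegral_runLaw_succ (n : ℕ) {G : (ℕ → unitInterval × ℝ) → unitInterval × ℝ → ℝ≥0∞}
    (hG : Measurable (Function.uncurry G))
    (hpast : ∀ ω ω' z, (∀ s < n + 1, ω s = ω' s) → G ω z = G ω' z)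
    (hlaw : ∀ ω ω', (∀ s < n + 1, ω s = ω' s) →
      anytimeLaw m ν₀ (n + 1) ω = anytimeLaw m ν₀ (n + 1) ω') :
    ∫⁻ ω, G ω (ω (n + 1)) ∂(runLaw m ν₀ E)
      = ∫⁻ ω, ∫⁻ x, ∫⁻ y, G ω (x, y) ∂(E.reward (n + 1) x) ∂(anytimeLaw m ν₀ (n + 1) ω)
        ∂(runLaw m ν₀ E) := by
  have hprob : IsProbabilityMeasure (anytimeLaw m ν₀ 0 (fun _ => (0, 0))) :=
    isProbabilityMeasure_medzoLaw _ _ _ _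
  have hmap := Kernel.map_frestrictLe_trajMeasure_compProd_eq_map_trajMeasure
    (X := fun _ => unitInterval × ℝ) (κ := roundKernel m ν₀ E)
    (μ₀ := anytimeLaw m ν₀ 0 (fun _ => (0, 0)) ⊗ₘ E.reward 0) (a := n)
  change (runLaw m ν₀ E).map _ ⊗ₘ _ = (runLaw m ν₀ E).map _ at hmap
  have hfr : Measurable (Preorder.frestrictLe (π := fun _ => unitInterval × ℝ) n) := by fun_prop
  have hext : ∀ ω : ℕ → unitInterval × ℝ, ∀ s < n + 1,
      extend n (Preorder.frestrictLe (π := fun _ => unitInterval × ℝ) n ω) s = ω s :=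
    fun ω s hs => extend_frestrictLe n ω (by omega)
  have hG' : Measurable (fun q : ((i : Finset.Iic n) → unitInterval × ℝ) × (unitInterval × ℝ) =>
      G (extend n q.1) q.2) :=
    hG.comp (((measurable_extend n).comp measurable_fst).prodMk measurable_snd)
  have h1 : ∫⁻ ω, G ω (ω (n + 1)) ∂(runLaw m ν₀ E)
      = ∫⁻ q, G (extend n q.1) q.2 ∂((runLaw m ν₀ E).map
        (fun x => (Preorder.frestrictLe (π := fun _ => unitInterval × ℝ) n x, x (n + 1)))) := by
    rw [lintegral_map hG' (by fun_prop)]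
    exact lintegral_congr fun ω => (hpast _ _ _ (hext ω)).symm
  rw [h1, ← hmap, Measure.lintegral_compProd hG', lintegral_map _ hfr]
  · refine lintegral_congr fun ω => ?_
    have hGω : Measurable fun z => G (extend n (Preorder.frestrictLe n ω)) z :=
      hG.comp (measurable_const.prodMk measurable_id)
    rw [roundKernel, Kernel.lintegral_compProd _ _ _ hGω]
    have h2 : armKernel m ν₀ n (Preorder.frestrictLe (π := fun _ => unitInterval × ℝ) n ω)
        = anytimeLaw m ν₀ (n + 1) ω := hlaw _ _ (hext ω)
    rw [h2]
    refine lintegral_congr fun x => ?_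
    rw [Kernel.prodMkLeft_apply]
    exact lintegral_congr fun y => hpast _ _ _ (hext ω)
  · exact hG'.lintegral_kernel_prod_right

/-- When the arm is drawn from a probability measure, the reward is `1/2`-subgaussian. -/
lemma Environment.lintegral_exp_le (t : ℕ) (π : Measure unitInterval) [IsProbabilityMeasure π]
    (θ : ℝ) :
    ∫⁻ x, ∫⁻ y, ENNReal.ofReal (Real.exp (θ * (y - ∫ x, E.f x ∂π))) ∂(E.reward t x) ∂π
      ≤ ENNReal.ofReal (Real.exp (θ ^ 2 / 4)) := by
  set c := ∫ x, E.f x ∂π with hc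
  have hin : ∀ x, ∫⁻ y, ENNReal.ofReal (Real.exp (θ * (y - c))) ∂(E.reward t x)
      ≤ ENNReal.ofReal (Real.exp (θ * (E.f x - c))) * ENNReal.ofReal (Real.exp (θ ^ 2 / 8)) := by
    intro x
    have hs := E.subgaussian t x
    have h1 : ∀ y, ENNReal.ofReal (Real.exp (θ * (y - c)))
        = ENNReal.ofReal (Real.exp (θ * (E.f x - c)))
          * ENNReal.ofReal (Real.exp (θ * (y - E.f x))) := by
      intro y
      rw [← ENNReal.ofReal_mul (Real.exp_pos _).le, ← Real.exp_add]
      congr 2; ring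
    rw [lintegral_congr h1, lintegral_const_mul _ (by fun_prop)]
    gcongr
    rw [← ofReal_integral_eq_lintegral_ofReal (hs.integrable_exp_mul θ)
      (Filter.Eventually.of_forall fun _ => (Real.exp_pos _).le)]
    refine ENNReal.ofReal_le_ofReal ((hs.mgf_le θ).trans (Real.exp_le_exp.2 (le_of_eq ?_)))
    push_cast; ring
  refine (lintegral_mono hin).trans ?_
  rw [lintegral_mul_const _ (by have := E.measurable_f; fun_prop)]
  -- Hoeffding's lemma for f ∈ [0, 1] under π contributes θ²/8, to be added to the θ²/8 of the
  -- reward noise.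
  have hH := hasSubgaussianMGF_of_mem_Icc (μ := π) (a := 0) (b := 1) E.measurable_f.aemeasurable
    (Filter.Eventually.of_forall E.f_mem)
  rw [← ofReal_integral_eq_lintegral_ofReal (hH.integrable_exp_mul θ)
      (Filter.Eventually.of_forall fun _ => (Real.exp_pos _).le),
    ← ENNReal.ofReal_mul (integral_nonneg fun _ => (Real.exp_pos _).le)]
  refine ENNReal.ofReal_le_ofReal ?_
  have h2 := hH.mgf_le θ
  calc _ ≤ Real.exp (((‖(1 : ℝ) - 0‖₊ / 2) ^ 2 : ℝ≥0) * θ ^ 2 / 2) * Real.exp (θ ^ 2 / 8) := by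
        gcongr
        exact h2
    _ = _ := by
        rw [← Real.exp_add]
        congr 1
        simp
        ring

lemma Environment.integral_mem_Icc (π : Measure unitInterval) [IsProbabilityMeasure π] :
    ∫ x, E.f x ∂π ∈ Set.Icc (0 : ℝ) 1 := by
  have hi : Integrable E.f π := Integrable.of_mem_Icc 0 1 E.measurable_f.aemeasurable
    (Filter.Eventually.of_forall E.f_mem)
  refine ⟨integral_nonneg fun x => (E.f_mem x).1, ?_⟩
  have := integral_mono hi (integrable_const (1 : ℝ)) fun x => (E.f_mem x).2
  simpa using this

lemma Environment.integral_empirical (ω : ℕ → unitInterval × ℝ) (start n : ℕ) :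
    ∫ x, E.f x ∂(empirical ω start n)
      = (n : ℝ)⁻¹ * ∑ s ∈ Finset.range n, E.f (ω (start + s)).1 := by
  unfold empirical
  rw [integral_smul_measure, integral_finsetSum_measure]
  · simp [ENNReal.toReal_inv]
  · intro s _
    exact Integrable.of_mem_Icc 0 1 E.measurable_f.aemeasurable
      (Filter.Eventually.of_forall E.f_mem)

instance (m : ℝ) (i r : ℕ) (ω : ℕ → unitInterval × ℝ) (k : ℕ) :
    IsProbabilityMeasure (phaseMeasure m i r ω k) :=
  isProbabilityMeasure_regimeMeasure _ _ _ _

/-- The mean payoff of the `k`-th measure in the regime `r + 1` of the phase `i`. -/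
noncomputable def phaseMean (i r k : ℕ) (ω : ℕ → unitInterval × ℝ) : ℝ :=
  ∫ x, E.f x ∂(phaseMeasure m i r ω k)

lemma measurable_phaseMean (i r k : ℕ) : Measurable (phaseMean m E i r k) := by
  unfold phaseMean phaseMeasure regimeMeasure
  split_ifs
  · exact measurable_const
  · simp only [Environment.integral_empirical]
    refine Measurable.const_mul (Finset.measurable_sum _ fun s _ => ?_) _
    exact E.measurable_f.comp (measurable_fst.comp (measurable_pi_apply _))

lemma phaseMean_mem_Icc (i r k : ℕ) (ω : ℕ → unitInterval × ℝ) :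
    phaseMean m E i r k ω ∈ Set.Icc (0 : ℝ) 1 := E.integral_mem_Icc _

lemma integrable_payoff (t : ℕ) : Integrable (fun ω => E.f (ω t).1) (runLaw m ν₀ E) :=
  Integrable.of_mem_Icc 0 1
    (E.measurable_f.comp (measurable_fst.comp (measurable_pi_apply t))).aemeasurable
    (Filter.Eventually.of_forall fun _ => E.f_mem _)

variable {m} {i r : ℕ}

/-- Given the past, the point is drawn from the measure selected by MOSS, and both the selection and
the means are functions of the past. The disintegration thus reduces the claim to
`Environment.lintegral_exp_le`. -/
lemma subgaussianRewards_regime (hi : 1 ≤ i) (hr : r < phaseLevel m i) {τ : ℕ}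
    (hτ : τ ≤ 2 ^ (phaseLevel m i + (r + 1))) (hτi : regimeEnd (phaseLevel m i) r + τ ≤ 2 ^ i) :
    SubgaussianRewards (runLaw m ν₀ E) (2 ^ (phaseLevel m i + (r + 1))) (cells m i r + r) τ
      (fun s ω => (ω (regimeStart m i r + s)).2) (phaseMean m E i r) := by
  intro t ht θ g hg hgp
  have hK : 0 < cells m i r + r := by have := cells_pos m i r; omega
  set n := 2 ^ (phaseLevel m i + (r + 1))
  set A : (ℕ → unitInterval × ℝ) → ℕ := fun ω =>
    mossArm n (cells m i r + r) (fun s => (ω (regimeStart m i r + s)).2) t with hA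
  have hY : ∀ s, Measurable fun ω : ℕ → unitInterval × ℝ => (ω (regimeStart m i r + s)).2 :=
    fun s => measurable_snd.comp (measurable_pi_apply _)
  have hAm : Measurable fun ω => phaseMean m E i r (A ω) ω :=
    measurable_mean_mossArm hK hY (fun k _ => measurable_phaseMean m E i r k) t
  -- The transition kernels only describe rounds after round 0, which belongs to phase 0.
  have hs0 : 1 ≤ regimeStart m i r := by
    have : 2 ^ 1 ≤ 2 ^ i := Nat.pow_le_pow_right (by norm_num) hi
    unfold regimeStart; omega
  obtain ⟨q, hq⟩ : ∃ q, regimeStart m i r + t = q + 1 := ⟨regimeStart m i r + t - 1, by omega⟩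
  have hmean : ∀ ω ω' : ℕ → unitInterval × ℝ, (∀ s < regimeStart m i r + t, ω s = ω' s) →
      ∀ k < cells m i r + r, phaseMean m E i r k ω = phaseMean m E i r k ω' := by
    intro ω ω' h k hk
    rw [phaseMean, phaseMean, phaseMeasure_congr hk fun s hs => h s (by omega)]
  have hAc : ∀ ω ω' : ℕ → unitInterval × ℝ, (∀ s < regimeStart m i r + t, ω s = ω' s) →
      A ω = A ω' := fun ω ω' h => mossArm_congr _ _ t fun s hs => by rw [h _ (by omega)]
  have hstep := lintegral_runLaw_succ m ν₀ E q
    (G := fun ω z => g ω * ENNReal.ofReal (Real.exp (θ * (z.2 - phaseMean m E i r (A ω) ω))))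
    (by
      have h1 : Measurable fun q : (ℕ → unitInterval × ℝ) × (unitInterval × ℝ) => g q.1 :=
        hg.comp measurable_fst
      have h2 : Measurable fun q : (ℕ → unitInterval × ℝ) × (unitInterval × ℝ) =>
          phaseMean m E i r (A q.1) q.1 := hAm.comp measurable_fst
      refine h1.mul ?_
      refine ENNReal.measurable_ofReal.comp (Real.measurable_exp.comp ?_)
      exact ((measurable_snd.comp measurable_snd).sub h2).const_mul θ)
    (by
      intro ω ω' z h
      rw [← hq] at h
      have e1 : g ω = g ω' := hgp ω ω' (fun s hs => by
        change (ω _).2 = (ω' _).2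
        rw [h _ (by omega)]) (hmean ω ω' h)
      rw [e1, hAc ω ω' h, hmean ω ω' h _ (mossArm_lt _ hK _ _)])
    (by
      intro ω ω' h
      rw [← hq] at h ⊢
      exact anytimeLaw_congr_regime ν₀ hr (by omega) (by omega) h)
  rw [← hq] at hstep
  refine (le_of_eq hstep).trans (lintegral_mono fun ω => ?_)
  have hin : ∀ x, ∫⁻ y, g ω * ENNReal.ofReal
      (Real.exp (θ * (y - phaseMean m E i r (A ω) ω))) ∂(E.reward (regimeStart m i r + t) x)
      = g ω * ∫⁻ y, ENNReal.ofReal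
      (Real.exp (θ * (y - phaseMean m E i r (A ω) ω))) ∂(E.reward (regimeStart m i r + t) x) :=
    fun x => lintegral_const_mul _ (by fun_prop)
  dsimp only
  rw [lintegral_congr hin, lintegral_const_mul]
  · gcongr
    rw [anytimeLaw_regime ν₀ hr (by omega) (by omega)]
    exact E.lintegral_exp_le _ (phaseMeasure m i r ω (A ω)) θ
  · have : Measurable fun y : ℝ => ENNReal.ofReal
        (Real.exp (θ * (y - phaseMean m E i r (A ω) ω))) := by fun_prop
    exact this.lintegral_kernel

/-- This transfers the regret of MOSS, counted on the means of the measures, to the points actually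
played. -/
lemma integral_payoff_regime (hi : 1 ≤ i) (hr : r < phaseLevel m i) {t : ℕ}
    (ht : t < 2 ^ (phaseLevel m i + (r + 1))) (hti : regimeEnd (phaseLevel m i) r + t < 2 ^ i) :
    ∫ ω, E.f (ω (regimeStart m i r + t)).1 ∂(runLaw m ν₀ E)
      = ∫ ω, phaseMean m E i r (mossArm (2 ^ (phaseLevel m i + (r + 1))) (cells m i r + r)
        (fun s => (ω (regimeStart m i r + s)).2) t) ω ∂(runLaw m ν₀ E) := by
  have hK : 0 < cells m i r + r := by have := cells_pos m i r; omega
  have hs0 : 1 ≤ regimeStart m i r := by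
    have : 2 ^ 1 ≤ 2 ^ i := Nat.pow_le_pow_right (by norm_num) hi
    unfold regimeStart; omega
  have hY : ∀ s, Measurable fun ω : ℕ → unitInterval × ℝ => (ω (regimeStart m i r + s)).2 :=
    fun s => measurable_snd.comp (measurable_pi_apply _)
  obtain ⟨q, hq⟩ : ∃ q, regimeStart m i r + t = q + 1 := ⟨regimeStart m i r + t - 1, by omega⟩
  have hstep := lintegral_runLaw_succ m ν₀ E q (G := fun _ z => ENNReal.ofReal (E.f z.1))
    (ENNReal.measurable_ofReal.comp
      (E.measurable_f.comp (measurable_fst.comp measurable_snd)))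
    (fun _ _ _ _ => rfl)
    (by
      intro ω ω' h
      rw [← hq] at h ⊢
      exact anytimeLaw_congr_regime ν₀ hr ht hti h)
  rw [← hq] at hstep
  rw [integral_eq_lintegral_of_nonneg_ae (Filter.Eventually.of_forall fun ω => (E.f_mem _).1)
    (integrable_payoff m ν₀ E _).1, hstep,
    integral_eq_lintegral_of_nonneg_ae
      (Filter.Eventually.of_forall fun ω => (phaseMean_mem_Icc m E i r _ ω).1)
      (measurable_mean_mossArm hK hY
        (fun k _ => measurable_phaseMean m E i r k) t).aestronglyMeasurable]
  congr 1
  refine lintegral_congr fun ω => ?_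
  simp only [lintegral_const, measure_univ, mul_one]
  rw [anytimeLaw_regime ν₀ hr ht hti, phaseMean, ofReal_integral_eq_lintegral_ofReal
    (Integrable.of_mem_Icc 0 1 E.measurable_f.aemeasurable
      (Filter.Eventually.of_forall E.f_mem)) (Filter.Eventually.of_forall fun x => (E.f_mem x).1)]

/-- The expected regret of the round `t`. -/
noncomputable def gap (m : ℝ) (ν₀ : Measure unitInterval) [IsProbabilityMeasure ν₀]
    (E : Environment) (t : ℕ) : ℝ :=
  (⨆ x, E.f x) - ∫ ω, E.f (ω t).1 ∂(runLaw m ν₀ E)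

/-- In each regime, the regret with respect to a fixed available measure is that of MOSS. -/
lemma sum_gap_regime_le (hi : 1 ≤ i) (hr : r < phaseLevel m i) {τ : ℕ}
    (hτ : τ ≤ 2 ^ (phaseLevel m i + (r + 1))) (hτi : regimeEnd (phaseLevel m i) r + τ ≤ 2 ^ i)
    (hKn : cells m i r + r ≤ 2 ^ (phaseLevel m i + (r + 1))) {j : ℕ} (hj : j < cells m i r + r) :
    ∑ t ∈ Finset.range τ, gap m ν₀ E (regimeStart m i r + t)
      ≤ τ * ((⨆ x, E.f x) - ∫ ω, phaseMean m E i r j ω ∂(runLaw m ν₀ E))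
        + 40 * Real.sqrt ((cells m i r + r : ℕ) * (2 ^ (phaseLevel m i + (r + 1)) : ℕ)) := by
  have hK : 0 < cells m i r + r := by have := cells_pos m i r; omega
  have hY : ∀ s, Measurable fun ω : ℕ → unitInterval × ℝ => (ω (regimeStart m i r + s)).2 :=
    fun s => measurable_snd.comp (measurable_pi_apply _)
  have hint : ∀ k, Integrable (phaseMean m E i r k) (runLaw m ν₀ E) := fun k =>
    Integrable.of_mem_Icc 0 1 (measurable_phaseMean m E i r k).aemeasurable
      (Filter.Eventually.of_forall fun ω => phaseMean_mem_Icc m E i r k ω)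
  have hintA : ∀ t, Integrable (fun ω => phaseMean m E i r
      (mossArm (2 ^ (phaseLevel m i + (r + 1))) (cells m i r + r)
        (fun s => (ω (regimeStart m i r + s)).2) t) ω) (runLaw m ν₀ E) := fun t =>
    Integrable.of_mem_Icc 0 1 (measurable_mean_mossArm hK hY
      (fun k _ => measurable_phaseMean m E i r k) t).aemeasurable
      (Filter.Eventually.of_forall fun ω => phaseMean_mem_Icc m E i r _ ω)
  have h := moss_regret_le hK hKn hτ hY (fun k _ => measurable_phaseMean m E i r k)
    (fun k _ ω => phaseMean_mem_Icc m E i r k ω) (subgaussianRewards_regime ν₀ E hi hr hτ hτi) hj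
  have hsub : ∀ t, Integrable (fun ω => phaseMean m E i r j ω - phaseMean m E i r
      (mossArm (2 ^ (phaseLevel m i + (r + 1))) (cells m i r + r)
        (fun s => (ω (regimeStart m i r + s)).2) t) ω) (runLaw m ν₀ E) :=
    fun t => (hint j).sub (hintA t)
  rw [integral_finsetSum _ fun t _ => hsub t] at h
  have h2 : ∀ t ∈ Finset.range τ, gap m ν₀ E (regimeStart m i r + t)
      = ((⨆ x, E.f x) - ∫ ω, phaseMean m E i r j ω ∂(runLaw m ν₀ E))
        + ∫ ω, (phaseMean m E i r j ω - phaseMean m E i r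
          (mossArm (2 ^ (phaseLevel m i + (r + 1))) (cells m i r + r)
          (fun s => (ω (regimeStart m i r + s)).2) t) ω) ∂(runLaw m ν₀ E) := by
    intro t ht
    have ht' := Finset.mem_range.1 ht
    rw [integral_sub (hint j) (hintA t), gap,
      integral_payoff_regime ν₀ E hi hr (by omega) (by omega)]
    ring
  rw [Finset.sum_congr rfl h2, Finset.sum_add_distrib, Finset.sum_const, Finset.card_range,
    nsmul_eq_mul]
  gcongr

lemma bddAbove_payoff : BddAbove (Set.range E.f) :=
  ⟨1, by rintro _ ⟨x, rfl⟩; exact (E.f_mem x).2⟩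

lemma gap_nonneg (t : ℕ) : 0 ≤ gap m ν₀ E t := by
  have h := integral_mono (integrable_payoff m ν₀ E t) (integrable_const (⨆ x, E.f x))
    fun ω => le_ciSup (bddAbove_payoff E) (ω t).1
  rw [integral_const, probReal_univ, one_smul] at h
  exact sub_nonneg.2 h

lemma gap_le_one (t : ℕ) : gap m ν₀ E t ≤ 1 := by
  have h1 : (⨆ x, E.f x) ≤ 1 := ciSup_le fun x => (E.f_mem x).2
  have h2 : 0 ≤ ∫ ω, E.f (ω t).1 ∂(runLaw m ν₀ E) := integral_nonneg fun ω => (E.f_mem _).1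
  unfold gap; linarith

lemma regret_eq_sum_gap (T : ℕ) :
    regret m ν₀ E T = ∑ t ∈ Finset.range T, gap m ν₀ E t := by
  unfold regret gap
  rw [integral_finsetSum _ fun t _ => integrable_payoff m ν₀ E t, Finset.sum_sub_distrib]
  simp

/-- The regret with respect to the empirical measure of a previous regime. -/
lemma phaseMean_empirical {r' : ℕ} :
    (⨆ x, E.f x) - ∫ ω, phaseMean m E i r (cells m i r + r') ω ∂(runLaw m ν₀ E)
      = (∑ t ∈ Finset.range (2 ^ (phaseLevel m i + (r' + 1))), gap m ν₀ E (regimeStart m i r' + t))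
        / 2 ^ (phaseLevel m i + (r' + 1)) := by
  have h1 : ∀ ω, phaseMean m E i r (cells m i r + r') ω
      = ((2 ^ (phaseLevel m i + (r' + 1)) : ℕ) : ℝ)⁻¹
        * ∑ s ∈ Finset.range (2 ^ (phaseLevel m i + (r' + 1))),
          E.f (ω (regimeStart m i r' + s)).1 := by
    intro ω
    rw [phaseMean, phaseMeasure, regimeMeasure, if_neg (by omega), E.integral_empirical]
    simp only [Nat.add_sub_cancel_left, regimeStart, add_assoc]
  simp only [h1, gap]
  rw [integral_const_mul, integral_finsetSum _ fun t _ => integrable_payoff m ν₀ E _,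
    Finset.sum_sub_distrib, Finset.sum_const, Finset.card_range, nsmul_eq_mul]
  push_cast
  field_simp

/-! ### Discretization error -/

lemma exists_cell {K : ℕ} (hK : 0 < K) (x : unitInterval) :
    ∃ k < K, (k : ℝ) / K ≤ x ∧ (x : ℝ) ≤ ((k : ℝ) + 1) / K := by
  have hK' : (0 : ℝ) < K := by exact_mod_cast hK
  have hx0 : 0 ≤ (x : ℝ) * K := mul_nonneg x.2.1 hK'.le
  rcases eq_or_lt_of_le x.2.2 with h | h
  · refine ⟨K - 1, by omega, ?_, ?_⟩
    · rw [h, div_le_one hK']; exact_mod_cast Nat.sub_le _ _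
    · rw [h, one_le_div hK', Nat.cast_sub hK]; simp
  · refine ⟨⌊(x : ℝ) * K⌋₊, ?_, ?_, ?_⟩
    · rw [Nat.floor_lt hx0]; nlinarith
    · rw [div_le_iff₀ hK']; exact Nat.floor_le hx0
    · rw [le_div_iff₀ hK']; exact (Nat.lt_floor_add_one _).le

/-- The approximation error of the discretization. -/
lemma exists_cell_mean_ge {L α : ℝ} (hα : 0 < α) (hL : 0 < L) (hf : E.f ∈ holderClass L α) {K : ℕ}
    (hK : 0 < K) : ∃ k < K, (⨆ x, E.f x) - ∫ x, E.f x ∂(uniformCell K k) ≤ L * ((K : ℝ)⁻¹) ^ α := by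
  obtain ⟨x₀, hx₀, hH⟩ := hf
  have hK' : (0 : ℝ) < K := by exact_mod_cast hK
  obtain ⟨k, hk, h1, h2⟩ := exists_cell hK x₀
  refine ⟨k, hk, ?_⟩
  have hp := isProbabilityMeasure_uniformCell hk
  have hae : ∀ᵐ x ∂(uniformCell K k), (⨆ x, E.f x) - L * ((K : ℝ)⁻¹) ^ α ≤ E.f x := by
    have hm : MeasurableSet {x : unitInterval | (k : ℝ) / K ≤ x ∧ (x : ℝ) ≤ ((k : ℝ) + 1) / K} :=
      (measurableSet_le measurable_const measurable_subtype_coe).inter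
        (measurableSet_le measurable_subtype_coe measurable_const)
    filter_upwards [ae_cond_mem hm] with x hx
    have h3 : |(x₀ : ℝ) - x| ≤ (K : ℝ)⁻¹ := by
      have : ((k : ℝ) + 1) / K = k / K + (K : ℝ)⁻¹ := by ring
      have ha := hx.1
      have hb := hx.2
      rw [abs_le]; constructor <;> linarith
    have h4 : |(x₀ : ℝ) - x| ^ α ≤ ((K : ℝ)⁻¹) ^ α := Real.rpow_le_rpow (abs_nonneg _) h3 hα.le
    have h5 := (le_abs_self _).trans (hH x)
    have h6 := mul_le_mul_of_nonneg_left h4 hL.le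
    linarith
  have hi : Integrable E.f (uniformCell K k) :=
    Integrable.of_mem_Icc 0 1 E.measurable_f.aemeasurable (Filter.Eventually.of_forall E.f_mem)
  have := integral_mono_ae (integrable_const _) hi hae
  rw [integral_const, probReal_univ, one_smul] at this
  linarith

end RunLaw

/-! ### Regret of a phase -/

section Phase

lemma regimeEnd_add (p r : ℕ) : regimeEnd p r + 2 ^ (p + 1) = 2 ^ (p + r + 1) := by
  induction r with
  | zero => simp [regimeEnd_zero]
  | succ r ih =>
    rw [regimeEnd_succ]
    have : 2 ^ (p + (r + 1) + 1) = 2 ^ (p + r + 1) + 2 ^ (p + (r + 1)) := by ring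
    omega

/-- The p regimes last 2^(2p+1) - 2^(p+1) ≥ 4^p rounds in total, so a phase of 2^i rounds ends
before they do. -/
lemma two_pow_le_regimeEnd {p i : ℕ} (hp : 1 ≤ p) (hi : i ≤ 2 * p) : 2 ^ i ≤ regimeEnd p p := by
  have h1 := regimeEnd_add p p
  have h2 : 2 ^ i ≤ 2 ^ (2 * p) := Nat.pow_le_pow_right (by norm_num) hi
  have h3 : 2 ^ (p + 1) ≤ 2 ^ (2 * p) := Nat.pow_le_pow_right (by norm_num) (by omega)
  have h4 : 2 ^ (p + p + 1) = 2 * 2 ^ (2 * p) := by ring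
  omega

/-- The number of rounds of the regime `r + 1` among the first `H` rounds of MeDZO. -/
def regimeRounds (p H r : ℕ) : ℕ := min (2 ^ (p + (r + 1))) (H - regimeEnd p r)

/-- Truncated subtraction assigns no round to the regimes that start after H. -/
lemma sum_regimeRounds (p H R : ℕ) (g : ℕ → ℝ) :
    ∑ t ∈ Finset.range (min H (regimeEnd p R)), g t
      = ∑ r ∈ Finset.range R, ∑ t ∈ Finset.range (regimeRounds p H r), g (regimeEnd p r + t) := by
  induction R with
  | zero => simp [regimeEnd_zero]
  | succ R ih =>
    rw [Finset.sum_range_succ, ← ih, regimeEnd_succ]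
    unfold regimeRounds
    rcases le_total H (regimeEnd p R) with h | h
    · rw [Nat.sub_eq_zero_of_le h, min_eq_left h,
        min_eq_left (h.trans (Nat.le_add_right _ _))]
      simp
    · rw [min_eq_right h, ← Finset.sum_range_add]
      congr 2
      omega

lemma sum_regimeRounds_card {p H R : ℕ} (h : H ≤ regimeEnd p R) :
    ∑ r ∈ Finset.range R, (regimeRounds p H r : ℝ) = H := by
  have := sum_regimeRounds p H R (fun _ => 1)
  simp only [Finset.sum_const, Finset.card_range, nsmul_eq_mul, mul_one, min_eq_left h] at this
  exact this.symm

/-- Cells times length is 4·4^p in every regime, and the r ≤ p - 1 empirical arms add at most (p -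
1)·4^p. -/
lemma cells_add_mul_le {m : ℝ} {i r : ℕ} (hr : r < phaseLevel m i) :
    Real.sqrt ((cells m i r + r : ℕ) * (2 ^ (phaseLevel m i + (r + 1)) : ℕ))
      ≤ 2 ^ phaseLevel m i * Real.sqrt (phaseLevel m i + 3) := by
  unfold cells
  set p := phaseLevel m i
  have h : (2 ^ (p + 1 - r) + r) * 2 ^ (p + (r + 1)) ≤ (2 ^ p) ^ 2 * (p + 3) := by
    have h1 : 2 ^ (p + 1 - r) * 2 ^ (p + (r + 1)) = (2 ^ p) ^ 2 * 4 := by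
      rw [← pow_add, ← pow_mul, show 4 = 2 ^ 2 by norm_num, ← pow_add]
      congr 1; omega
    have h2 : 2 ^ (p + (r + 1)) ≤ (2 ^ p) ^ 2 := by
      rw [← pow_mul]
      exact Nat.pow_le_pow_right (by norm_num) (by omega)
    have h3 : r * 2 ^ (p + (r + 1)) ≤ (p - 1) * (2 ^ p) ^ 2 :=
      Nat.mul_le_mul (by omega) h2
    obtain ⟨q, hq⟩ : ∃ q, p = q + 1 := ⟨p - 1, by omega⟩
    rw [add_mul, h1]
    refine (Nat.add_le_add_left h3 _).trans (le_of_eq ?_)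
    generalize (2 ^ p) ^ 2 = x
    rw [hq, Nat.add_sub_cancel]
    ring
  rw [← Real.sqrt_sq (show (0 : ℝ) ≤ 2 ^ p by positivity), ← Real.sqrt_mul (by positivity)]
  refine Real.sqrt_le_sqrt ?_
  exact_mod_cast h

lemma cells_add_le {m : ℝ} {i r : ℕ} (hr : r < phaseLevel m i) :
    cells m i r + r ≤ 2 ^ (phaseLevel m i + (r + 1)) := by
  unfold cells
  set p := phaseLevel m i
  rcases Nat.eq_zero_or_pos r with h | h
  · simp [h]
  · have h1 : 2 ^ (p + 1 - r) ≤ 2 ^ p := Nat.pow_le_pow_right (by norm_num) (by omega)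
    have h2 : r < 2 ^ p := hr.trans p.lt_two_pow_self
    have h3 : 2 ^ (p + 1) ≤ 2 ^ (p + (r + 1)) := Nat.pow_le_pow_right (by norm_num) (by omega)
    rw [pow_succ] at h3
    omega

/-- The scale `2 ^ (-r)` at which the discretization error of the regime `r + 1` becomes too
large. -/
lemma inv_two_pow_le {p r L α : ℝ} (hα : 0 < α) (hL : 0 < L)
    (h : 1 < 2 ^ (r + 1) * L * 2 ^ (-((p + 1 - r) * α))) :
    (2 : ℝ) ^ (-r) ≤ 2 * L ^ (1 / (α + 1)) * 2 ^ (-(p * (α / (α + 1)))) := by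
  have h2 : (0 : ℝ) < 2 := by norm_num
  have hlog : 0 < (r + 1) * Real.log 2 + Real.log L + -((p + 1 - r) * α) * Real.log 2 := by
    have := Real.log_pos h
    rwa [Real.log_mul (by positivity) (by positivity), Real.log_mul (by positivity) hL.ne',
      Real.log_rpow h2, Real.log_rpow h2] at this
  rw [← Real.log_le_log_iff (by positivity) (by positivity), Real.log_mul (by positivity)
    (by positivity), Real.log_mul (by positivity) (by positivity), Real.log_rpow h2,
    Real.log_rpow h2, Real.log_rpow hL]
  have hl2 : 0 < Real.log 2 := Real.log_pos (by norm_num)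
  -- Multiplied by α + 1, the difference of the logarithms of the two sides is the logarithm of the
  -- hypothesis plus 2α log 2.
  have e : Real.log 2 + 1 / (α + 1) * Real.log L + -(p * (α / (α + 1))) * Real.log 2 - -r * Real.log 2
      = ((r + 1) * Real.log 2 + Real.log L + -((p + 1 - r) * α) * Real.log 2
        + 2 * α * Real.log 2) / (α + 1) := by
    field_simp
    ring
  have : 0 ≤ Real.log 2 + 1 / (α + 1) * Real.log L + -(p * (α / (α + 1))) * Real.log 2
      - -r * Real.log 2 := by rw [e]; positivity
  linarith

variable {m : ℝ} (ν₀ : Measure unitInterval) [IsProbabilityMeasure ν₀] (E : Environment) {i : ℕ}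

/-- Regret of a (possibly interrupted) regime with respect to the best cell. -/
lemma sum_gap_le_of_cell (hi : 1 ≤ i) {L α : ℝ} (hα : 0 < α) (hL : 0 < L)
    (hf : E.f ∈ holderClass L α) {r τ : ℕ} (hr : r < phaseLevel m i)
    (hτ : τ ≤ 2 ^ (phaseLevel m i + (r + 1))) (hτi : regimeEnd (phaseLevel m i) r + τ ≤ 2 ^ i) :
    ∑ t ∈ Finset.range τ, gap m ν₀ E (regimeStart m i r + t)
      ≤ τ * (L * ((cells m i r : ℝ)⁻¹) ^ α)
        + 40 * (2 ^ phaseLevel m i * Real.sqrt (phaseLevel m i + 3)) := by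
  obtain ⟨k, hk, hle⟩ := exists_cell_mean_ge E hα hL hf (cells_pos m i r)
  refine (sum_gap_regime_le ν₀ E hi hr hτ hτi (cells_add_le hr) (j := k) (by omega)).trans ?_
  have h1 : ∀ ω, phaseMean m E i r k ω = ∫ x, E.f x ∂(uniformCell (cells m i r) k) := by
    intro ω
    rw [phaseMean, phaseMeasure, regimeMeasure, if_pos hk]
  simp only [h1, integral_const, probReal_univ, one_smul]
  gcongr
  exact cells_add_mul_le hr

/-- Regret of a (possibly interrupted) regime with respect to the empirical measure of a previous
one. -/
lemma sum_gap_le_of_empirical (hi : 1 ≤ i) {q r τ : ℕ} (hq : q < r) (hr : r < phaseLevel m i)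
    (hτ : τ ≤ 2 ^ (phaseLevel m i + (r + 1))) (hτi : regimeEnd (phaseLevel m i) r + τ ≤ 2 ^ i) :
    ∑ t ∈ Finset.range τ, gap m ν₀ E (regimeStart m i r + t)
      ≤ τ * ((∑ t ∈ Finset.range (2 ^ (phaseLevel m i + (q + 1))),
          gap m ν₀ E (regimeStart m i q + t)) / 2 ^ (phaseLevel m i + (q + 1)))
        + 40 * (2 ^ phaseLevel m i * Real.sqrt (phaseLevel m i + 3)) := by
  refine (sum_gap_regime_le ν₀ E hi hr hτ hτi (cells_add_le hr) (j := cells m i r + q)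
    (by omega)).trans ?_
  rw [phaseMean_empirical]
  gcongr
  exact cells_add_mul_le hr

lemma inv_cells_rpow {r : ℕ} (hr : r < phaseLevel m i) (α : ℝ) :
    ((cells m i r : ℝ)⁻¹) ^ α = 2 ^ (-(((phaseLevel m i : ℝ) + 1 - r) * α)) := by
  unfold cells
  push_cast
  rw [← Real.rpow_natCast, Nat.cast_sub (by omega), ← Real.rpow_neg (by norm_num),
    ← Real.rpow_mul (by norm_num)]
  congr 1
  push_cast
  ring

/-- Regret of a (possibly interrupted) regime. -/
lemma sum_gap_regimeRounds_le (hi : 1 ≤ i) {L α : ℝ} (hα : 0 < α) (hL : 0 < L)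
    (hf : E.f ∈ holderClass L α) {r : ℕ} (hr : r < phaseLevel m i) :
    ∑ t ∈ Finset.range (regimeRounds (phaseLevel m i) (2 ^ i) r),
        gap m ν₀ E (regimeStart m i r + t)
      ≤ (2 ^ phaseLevel m i + regimeRounds (phaseLevel m i) (2 ^ i) r
          * (2 * L ^ (1 / (α + 1)) * 2 ^ (-((phaseLevel m i : ℝ) * (α / (α + 1))))))
        * (1 + 40 * Real.sqrt (phaseLevel m i + 3)) := by
  set p := phaseLevel m i with hp
  set W : ℝ := 2 * L ^ (1 / (α + 1)) * 2 ^ (-((p : ℝ) * (α / (α + 1)))) with hW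
  have hW0 : 0 ≤ W := by positivity
  set C : ℝ := 1 + 40 * Real.sqrt (p + 3) with hC
  have hC1 : 1 ≤ C := by rw [hC]; linarith [Real.sqrt_nonneg ((p : ℝ) + 3)]
  set τ := regimeRounds p (2 ^ i) r with hτdef
  have hτ : τ ≤ 2 ^ (p + (r + 1)) := min_le_left _ _
  have hτ' : τ ≤ 2 ^ i - regimeEnd p r := min_le_right _ _
  have hP : (0 : ℝ) < 2 ^ p := by positivity
  rcases Nat.eq_zero_or_pos τ with h0 | h0
  · rw [h0]; simp; positivity
  have hτi : regimeEnd p r + τ ≤ 2 ^ i := by omega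
  -- The criterion says that the discretization error accumulated over a full regime is at most 2^p,
  -- hence no larger than the scale of the MOSS cost.
  have hgood : ∀ q < p, ∀ σ : ℕ, σ ≤ 2 ^ (p + (q + 1)) → regimeEnd p q + σ ≤ 2 ^ i →
      (2 : ℝ) ^ ((q : ℝ) + 1) * L * 2 ^ (-(((p : ℝ) + 1 - q) * α)) ≤ 1 →
      ∑ t ∈ Finset.range σ, gap m ν₀ E (regimeStart m i q + t) ≤ 2 ^ p * C := by
    intro q hq σ hσ hσi hle
    refine (sum_gap_le_of_cell ν₀ E hi hα hL hf hq hσ hσi).trans ?_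
    rw [inv_cells_rpow hq, ← hp]
    have h1 : (σ : ℝ) * (L * 2 ^ (-(((p : ℝ) + 1 - q) * α))) ≤ 2 ^ p := by
      calc (σ : ℝ) * (L * 2 ^ (-(((p : ℝ) + 1 - q) * α)))
          ≤ (2 ^ (p + (q + 1)) : ℝ) * (L * 2 ^ (-(((p : ℝ) + 1 - q) * α))) := by
            gcongr
            exact_mod_cast hσ
        _ = 2 ^ p * ((2 : ℝ) ^ ((q : ℝ) + 1) * L * 2 ^ (-(((p : ℝ) + 1 - q) * α))) := by
            have : (2 : ℝ) ^ ((q : ℝ) + 1) = 2 ^ (q + 1) := by norm_cast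
            rw [this, pow_add]; ring
        _ ≤ 2 ^ p * 1 := by gcongr
        _ = 2 ^ p := mul_one _
    rw [hC]
    linarith
  by_cases hbad : ∃ q : ℕ, q ≤ r ∧
      1 < (2 : ℝ) ^ ((q : ℝ) + 1) * L * 2 ^ (-(((p : ℝ) + 1 - q) * α))
  · classical
    -- The first regime that fails the criterion: the failure bounds 2^(-q₀) by `W`, and minimality
    -- makes its predecessor, if any, a good reference.
    obtain ⟨hqr, hq⟩ := Nat.find_spec hbad
    have hmin := fun q (hq : q < Nat.find hbad) => Nat.find_min hbad hq
    generalize Nat.find hbad = q₀ at hqr hq hmin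
    have hWq := inv_two_pow_le hα hL hq
    rw [← hW] at hWq
    rcases Nat.eq_zero_or_pos q₀ with hz | hpos
    -- Failure at the very first regime means W ≥ 1, and the trivial regret of 1 per round suffices.
    · have h1 : 1 ≤ W := by simpa [hz] using hWq
      have h2 : ∑ t ∈ Finset.range τ, gap m ν₀ E (regimeStart m i r + t) ≤ τ := by
        refine (Finset.sum_le_sum fun t _ => gap_le_one ν₀ E _).trans ?_
        simp
      calc _ ≤ (τ : ℝ) := h2
        _ = (0 + τ * 1) * 1 := by ring
        _ ≤ (2 ^ p + τ * W) * C := by gcongr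
    · obtain ⟨q, rfl⟩ : ∃ q, q₀ = q + 1 := ⟨q₀ - 1, by omega⟩
      have hqgood : (2 : ℝ) ^ ((q : ℝ) + 1) * L * 2 ^ (-(((p : ℝ) + 1 - q) * α)) ≤ 1 := by
        by_contra h
        exact hmin q (by omega) ⟨by omega, not_le.1 h⟩
      -- Regime index `r` has been reached within the phase, so the earlier index `q` was played in
      -- full.
      have hfull : regimeEnd p q + 2 ^ (p + (q + 1)) ≤ 2 ^ i := by
        rw [← regimeEnd_succ]
        have := regimeEnd_mono p hqr
        omega
      have hS := hgood q (by omega) _ le_rfl hfull hqgood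
      refine (sum_gap_le_of_empirical ν₀ E hi (q := q) (by omega) hr hτ hτi).trans ?_
      rw [← hp]
      have h1 : (∑ t ∈ Finset.range (2 ^ (p + (q + 1))), gap m ν₀ E (regimeStart m i q + t))
          / 2 ^ (p + (q + 1)) ≤ W * C := by
        calc _ ≤ 2 ^ p * C / 2 ^ (p + (q + 1)) := by gcongr
          _ = 2 ^ (-((q + 1 : ℕ) : ℝ)) * C := by
            rw [Real.rpow_neg (by norm_num), Real.rpow_natCast, pow_add]
            field_simp
          _ ≤ W * C := by gcongr
      have h2 : 40 * (2 ^ p * Real.sqrt (p + 3)) ≤ 2 ^ p * C := by rw [hC]; linarith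
      calc _ ≤ (τ : ℝ) * (W * C) + 2 ^ p * C := by gcongr
        _ = _ := by ring
  · push Not at hbad
    refine (hgood r hr τ hτ hτi (hbad r le_rfl)).trans ?_
    have : 0 ≤ (τ : ℝ) * W := by positivity
    gcongr
    linarith

/-- Regret of a phase of the doubling trick. -/
lemma sum_gap_phase_le (hm : m ∈ Set.Icc (1 / 2 : ℝ) 1) (hi : 1 ≤ i) {L α : ℝ} (hα : 0 < α)
    (hL : 0 < L) (hf : E.f ∈ holderClass L α) :
    ∑ t ∈ Finset.range (2 ^ i), gap m ν₀ E (2 ^ i - 1 + t)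
      ≤ (phaseLevel m i * 2 ^ phaseLevel m i + 2 ^ i
          * (2 * L ^ (1 / (α + 1)) * 2 ^ (-((phaseLevel m i : ℝ) * (α / (α + 1))))))
        * (1 + 40 * Real.sqrt (phaseLevel m i + 3)) := by
  have hi' : (1 : ℝ) ≤ i := by exact_mod_cast hi
  have him : (i : ℝ) * m ≤ phaseLevel m i := Nat.le_ceil _
  have hp : 1 ≤ phaseLevel m i := Nat.ceil_pos.2 (by nlinarith [hm.1])
  -- Here m ≥ 1/2 makes the regimes long enough to cover the phase.
  have hi2 : i ≤ 2 * phaseLevel m i := by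
    have : (i : ℝ) ≤ 2 * phaseLevel m i := by nlinarith [hm.1]
    exact_mod_cast this
  have hcov := two_pow_le_regimeEnd hp hi2
  have h1 := sum_regimeRounds (phaseLevel m i) (2 ^ i) (phaseLevel m i)
    (fun t => gap m ν₀ E (2 ^ i - 1 + t))
  rw [min_eq_left hcov] at h1
  rw [h1]
  have h2 : ∀ r ∈ Finset.range (phaseLevel m i),
      ∑ t ∈ Finset.range (regimeRounds (phaseLevel m i) (2 ^ i) r),
        gap m ν₀ E (2 ^ i - 1 + (regimeEnd (phaseLevel m i) r + t))
      ≤ (2 ^ phaseLevel m i + regimeRounds (phaseLevel m i) (2 ^ i) r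
          * (2 * L ^ (1 / (α + 1)) * 2 ^ (-((phaseLevel m i : ℝ) * (α / (α + 1))))))
        * (1 + 40 * Real.sqrt (phaseLevel m i + 3)) := by
    intro r hr
    have := sum_gap_regimeRounds_le ν₀ E hi hα hL hf (Finset.mem_range.1 hr)
    simpa only [regimeStart, add_assoc] using this
  refine (Finset.sum_le_sum h2).trans (le_of_eq ?_)
  rw [← Finset.sum_mul, Finset.sum_add_distrib, ← Finset.sum_mul, sum_regimeRounds_card hcov]
  simp

/-- Regret of a phase of the doubling trick, in terms of the horizon. -/
lemma sum_gap_phase_le_horizon (hm : m ∈ Set.Icc (1 / 2 : ℝ) 1) (hi : 1 ≤ i) {L α : ℝ}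
    (hα : 0 < α) (hL : 0 < L) (hf : E.f ∈ holderClass L α) {T : ℝ} (hT : 2 ^ i ≤ T) :
    ∑ t ∈ Finset.range (2 ^ i), gap m ν₀ E (2 ^ i - 1 + t)
      ≤ (2 * (Real.logb 2 (T ^ m) + 1) * ((2 : ℝ) ^ m) ^ i
          + 2 * (T * L ^ (1 / (α + 1)) * (T ^ m) ^ (-(α / (α + 1)))))
        * (1 + 40 * Real.sqrt (Real.logb 2 (T ^ m) + 4)) := by
  refine (sum_gap_phase_le ν₀ E hm hi hα hL hf).trans ?_
  have hm0 : 0 ≤ m := by linarith [hm.1]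
  have hT0 : 0 < T := lt_of_lt_of_le (by positivity) hT
  have hlog : (i : ℝ) * m ≤ Real.logb 2 (T ^ m) := by
    rw [Real.logb_rpow_eq_mul_logb_of_pos hT0, mul_comm]
    gcongr
    rw [Real.le_logb_iff_rpow_le (by norm_num) hT0, Real.rpow_natCast]
    exact hT
  have hl0 : 0 ≤ Real.logb 2 (T ^ m) := le_trans (by positivity) hlog
  have hp1 : (phaseLevel m i : ℝ) ≤ i * m + 1 := (Nat.ceil_lt_add_one (by positivity)).le
  have hp2 : (i : ℝ) * m ≤ phaseLevel m i := Nat.le_ceil _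
  have hpow : (2 : ℝ) ^ phaseLevel m i ≤ 2 * ((2 : ℝ) ^ m) ^ i := by
    calc (2 : ℝ) ^ phaseLevel m i = 2 ^ (phaseLevel m i : ℝ) := (Real.rpow_natCast _ _).symm
      _ ≤ 2 ^ ((i : ℝ) * m + 1) := Real.rpow_le_rpow_of_exponent_le (by norm_num) hp1
      _ = 2 * ((2 : ℝ) ^ m) ^ i := by
        rw [Real.rpow_add (by norm_num), Real.rpow_one, mul_comm (i : ℝ), Real.rpow_mul
          (by norm_num), Real.rpow_natCast]
        ring
  set γ := α / (α + 1) with hγ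
  have hγ0 : 0 ≤ γ := by positivity
  have hγ1 : γ ≤ 1 := by rw [hγ, div_le_one (by positivity)]; linarith
  -- As p ≥ im, the product is at most (2^i)^(1 - mγ), which is monotone in 2^i because mγ ≤ 1.
  have hsecond : (2 : ℝ) ^ i * 2 ^ (-((phaseLevel m i : ℝ) * γ)) ≤ T * (T ^ m) ^ (-γ) := by
    have hβ : 0 ≤ 1 - m * γ := by
      have : m * γ ≤ 1 * 1 := mul_le_mul hm.2 hγ1 hγ0 (by norm_num)
      linarith
    calc (2 : ℝ) ^ i * 2 ^ (-((phaseLevel m i : ℝ) * γ))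
        ≤ (2 : ℝ) ^ i * 2 ^ (-((i : ℝ) * m * γ)) := by
          gcongr
          norm_num
      _ = ((2 : ℝ) ^ i) ^ (1 - m * γ) := by
          rw [← Real.rpow_natCast, ← Real.rpow_mul (by norm_num), ← Real.rpow_add (by norm_num)]
          congr 1; ring
      _ ≤ T ^ (1 - m * γ) := Real.rpow_le_rpow (by positivity) hT hβ
      _ = T * (T ^ m) ^ (-γ) := by
          rw [← Real.rpow_mul hT0.le, sub_eq_add_neg, Real.rpow_add hT0, Real.rpow_one]
          congr 2; ring
  have hLp : 0 < L ^ (1 / (α + 1)) := by positivity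
  refine mul_le_mul ?_ ?_ (by positivity) (by positivity)
  · refine add_le_add ?_ ?_
    · calc (phaseLevel m i : ℝ) * 2 ^ phaseLevel m i
          ≤ (Real.logb 2 (T ^ m) + 1) * (2 * ((2 : ℝ) ^ m) ^ i) := by
            gcongr
            linarith
        _ = _ := by ring
    · calc (2 : ℝ) ^ i * (2 * L ^ (1 / (α + 1)) * 2 ^ (-((phaseLevel m i : ℝ) * γ)))
          = 2 * L ^ (1 / (α + 1)) * ((2 : ℝ) ^ i * 2 ^ (-((phaseLevel m i : ℝ) * γ))) := by ring
        _ ≤ 2 * L ^ (1 / (α + 1)) * (T * (T ^ m) ^ (-γ)) := by gcongr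
        _ = _ := by ring
  · gcongr _ + 40 * Real.sqrt ?_
    linarith

end Phase

/-! ### The doubling trick -/

section Doubling

lemma sum_phases (g : ℕ → ℝ) (k : ℕ) :
    ∑ t ∈ Finset.range (2 ^ k - 1), g t
      = ∑ i ∈ Finset.range k, ∑ t ∈ Finset.range (2 ^ i), g (2 ^ i - 1 + t) := by
  induction k with
  | zero => simp
  | succ k ih =>
    rw [Finset.sum_range_succ, ← ih, ← Finset.sum_range_add]
    congr 2
    have : 1 ≤ 2 ^ k := Nat.one_le_two_pow
    rw [pow_succ]
    omega

/-- The induction needs 4x^k + x^(k+1) ≤ 4x^(k+1), that is x ≥ 4/3; the ratio 2^m ≥ √2 satisfies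
this. -/
lemma sum_pow_le {x : ℝ} (hx : 4 / 3 ≤ x) (k : ℕ) :
    ∑ i ∈ Finset.range k, x ^ (i + 1) ≤ 4 * x ^ k := by
  induction k with
  | zero => simp
  | succ k ih =>
    rw [Finset.sum_range_succ]
    have h : 0 < x ^ k := by positivity
    rw [pow_succ]
    nlinarith

/-- For l ≥ 1/2 everything compares to powers of √l: 12l + 8 ≤ 28l, √(l+4) ≤ 3√l and 1 ≤ 1.5√l. -/
lemma numerical_bound {l : ℝ} (hl : 1 / 2 ≤ l) :
    1 + (12 * l + 8) * (1 + 40 * Real.sqrt (l + 4)) ≤ 4000 * l ^ (3 / 2 : ℝ) := by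
  have hl0 : 0 ≤ l := by linarith
  obtain ⟨s, hs⟩ : ∃ s, s = Real.sqrt l := ⟨_, rfl⟩
  have hs0 : 0 ≤ s := hs ▸ Real.sqrt_nonneg l
  have hs2 : s ^ 2 = l := hs ▸ Real.sq_sqrt hl0
  have hpow : l ^ (3 / 2 : ℝ) = s ^ 3 := by
    rw [hs, Real.sqrt_eq_rpow, ← Real.rpow_natCast, ← Real.rpow_mul hl0]
    norm_num
  have h1 : 1 ≤ 1.5 * s := by nlinarith
  have h2 : Real.sqrt (l + 4) ≤ 3 * s :=
    Real.sqrt_le_iff.2 ⟨by positivity, by nlinarith⟩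
  rw [hpow]
  have h3 : 1 ≤ (1.5 * s) ^ 3 := one_le_pow₀ h1
  calc 1 + (12 * l + 8) * (1 + 40 * Real.sqrt (l + 4))
      ≤ (1.5 * s) ^ 3 + (28 * s ^ 2) * (1.5 * s + 40 * (3 * s)) := by
        gcongr
        linarith
    _ = 3405.375 * s ^ 3 := by ring
    _ ≤ 4000 * s ^ 3 := by gcongr; norm_num

/-- The regret bound for the doubling-trick version of MeDZO. -/
theorem regret_le {m : ℝ} (hm : m ∈ Set.Icc (1 / 2 : ℝ) 1) (ν₀ : Measure unitInterval)
    [IsProbabilityMeasure ν₀] {L α : ℝ} (hα : 0 < α) (hL : 0 < L) {T : ℕ} (hT : 2 ≤ T)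
    (E : Environment) (hf : E.f ∈ holderClass L α) :
    regret m ν₀ E T ≤ 4000 * (Real.logb 2 ((T : ℝ) ^ m)) ^ (3 / 2 : ℝ) * max ((T : ℝ) ^ m)
      ((T : ℝ) * L ^ (1 / (α + 1)) * ((T : ℝ) ^ m) ^ (-(α / (α + 1)))) := by
  have hT2 : (2 : ℝ) ≤ T := by exact_mod_cast hT
  have hT0 : (0 : ℝ) < T := by linarith
  have hm0 : 0 ≤ m := by linarith [hm.1]
  set D := max ((T : ℝ) ^ m) ((T : ℝ) * L ^ (1 / (α + 1)) * ((T : ℝ) ^ m) ^ (-(α / (α + 1))))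
    with hD
  set l := Real.logb 2 ((T : ℝ) ^ m) with hl
  set C := 1 + 40 * Real.sqrt (l + 4) with hC
  have hC0 : 0 ≤ C := by positivity
  have hlm : l = m * Real.logb 2 T := Real.logb_rpow_eq_mul_logb_of_pos hT0
  have hlog1 : 1 ≤ Real.logb 2 T := by
    rw [Real.le_logb_iff_rpow_le (by norm_num) hT0, Real.rpow_one]; exact hT2
  have hl2 : 1 / 2 ≤ l := by rw [hlm]; nlinarith [hm.1]
  set k := Nat.log 2 T with hk
  have hkT : 2 ^ k ≤ T := Nat.pow_log_le_self 2 (by omega)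
  have hTk : T < 2 ^ (k + 1) := Nat.lt_pow_succ_log_self (by norm_num) T
  have hkT' : (2 : ℝ) ^ k ≤ T := by exact_mod_cast hkT
  -- Since m ≥ 1/2, the number of phases is comparable to l. Together with the √l inside `C`, this
  -- gives the power 3/2.
  have hk2 : (k : ℝ) ≤ 2 * l := by
    have : (k : ℝ) ≤ Real.logb 2 T := by
      rw [Real.le_logb_iff_rpow_le (by norm_num) hT0, Real.rpow_natCast]; exact hkT'
    rw [hlm]; nlinarith [hm.1]
  have hD1 : 1 ≤ D := (Real.one_le_rpow (by linarith) hm0).trans (le_max_left _ _)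
  have hD2 : (T : ℝ) ^ m ≤ D := le_max_left _ _
  have hD3 : (T : ℝ) * L ^ (1 / (α + 1)) * ((T : ℝ) ^ m) ^ (-(α / (α + 1))) ≤ D := le_max_right _ _
  have h2m : (4 / 3 : ℝ) ≤ 2 ^ m := by
    calc (4 / 3 : ℝ) ≤ Real.sqrt 2 := Real.le_sqrt_of_sq_le (by norm_num)
      _ = 2 ^ (1 / 2 : ℝ) := Real.sqrt_eq_rpow 2
      _ ≤ 2 ^ m := Real.rpow_le_rpow_of_exponent_le (by norm_num) hm.1
  have hgeom : ∑ i ∈ Finset.range k, ((2 : ℝ) ^ m) ^ (i + 1) ≤ 4 * D := by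
    refine (sum_pow_le h2m k).trans ?_
    have : ((2 : ℝ) ^ m) ^ k ≤ (T : ℝ) ^ m := by
      rw [← Real.rpow_natCast, ← Real.rpow_mul (by norm_num), mul_comm, Real.rpow_mul (by norm_num),
        Real.rpow_natCast]
      exact Real.rpow_le_rpow (by positivity) hkT' hm0
    linarith
  have hphase : ∀ i ∈ Finset.range k,
      ∑ t ∈ Finset.range (2 ^ (i + 1)), gap m ν₀ E (2 ^ (i + 1) - 1 + t)
        ≤ (2 * (l + 1) * ((2 : ℝ) ^ m) ^ (i + 1) + 2 * D) * C := by
    intro i hi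
    have hik : (2 : ℝ) ^ (i + 1) ≤ T := by
      refine le_trans (pow_le_pow_right₀ (by norm_num) ?_) hkT'
      have := Finset.mem_range.1 hi
      omega
    refine (sum_gap_phase_le_horizon ν₀ E hm (by omega) hα hL hf hik).trans ?_
    gcongr
  calc regret m ν₀ E T = ∑ t ∈ Finset.range T, gap m ν₀ E t := regret_eq_sum_gap ν₀ E T
    -- Expected regrets per round are nonnegative, so the phase in progress may be completed; its
    -- length 2^k is still at most T.
    _ ≤ ∑ t ∈ Finset.range (2 ^ (k + 1) - 1), gap m ν₀ E t :=
        Finset.sum_le_sum_of_subset_of_nonneg (Finset.range_mono (by omega))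
          fun t _ _ => gap_nonneg ν₀ E t
    _ = ∑ i ∈ Finset.range k, ∑ t ∈ Finset.range (2 ^ (i + 1)), gap m ν₀ E (2 ^ (i + 1) - 1 + t)
          + gap m ν₀ E 0 := by
        rw [sum_phases, Finset.sum_range_succ']
        simp
    -- The single round of phase 0 lies in no regime and is charged 1.
    _ ≤ ∑ i ∈ Finset.range k, (2 * (l + 1) * ((2 : ℝ) ^ m) ^ (i + 1) + 2 * D) * C + 1 :=
        add_le_add (Finset.sum_le_sum hphase) (gap_le_one ν₀ E 0)
    _ = (2 * (l + 1) * ∑ i ∈ Finset.range k, ((2 : ℝ) ^ m) ^ (i + 1) + k * (2 * D)) * C + 1 := by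
        rw [← Finset.sum_mul, Finset.sum_add_distrib, ← Finset.mul_sum]
        simp
    _ ≤ (2 * (l + 1) * (4 * D) + 2 * l * (2 * D)) * C + D := by gcongr
    _ = (1 + (12 * l + 8) * C) * D := by ring
    _ ≤ 4000 * l ^ (3 / 2 : ℝ) * D := by
        gcongr
        exact numerical_bound hl2

/-- The rate of the regret bound, for fixed parameters. -/
lemma isBigO_bound {m : ℝ} (hm : 0 ≤ m) {L α : ℝ} (hL : 0 < L) :
    (fun T : ℕ =>
        4000 * (Real.logb 2 ((T : ℝ) ^ m)) ^ (3 / 2 : ℝ) *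
          max ((T : ℝ) ^ m)
            ((T : ℝ) * L ^ (1 / (α + 1)) * ((T : ℝ) ^ m) ^ (-(α / (α + 1)))))
      =O[Filter.atTop]
        (fun T : ℕ => (Real.log (T : ℝ)) ^ (3 / 2 : ℝ) * (T : ℝ) ^ rate m α) := by
  refine Asymptotics.IsBigO.of_bound
    (4000 * (m / Real.log 2) ^ (3 / 2 : ℝ) * (1 + L ^ (1 / (α + 1)))) ?_
  filter_upwards [Filter.eventually_ge_atTop 1] with T hT
  have hT1 : (1 : ℝ) ≤ T := by exact_mod_cast hT
  have hT0 : (0 : ℝ) < T := by linarith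
  have hlog : 0 ≤ Real.log T := Real.log_nonneg hT1
  have hlog2 : 0 < Real.log 2 := Real.log_pos (by norm_num)
  have hLp : 0 < L ^ (1 / (α + 1)) := by positivity
  have e1 : (Real.logb 2 ((T : ℝ) ^ m)) ^ (3 / 2 : ℝ)
      = (m / Real.log 2) ^ (3 / 2 : ℝ) * (Real.log T) ^ (3 / 2 : ℝ) := by
    rw [Real.logb, Real.log_rpow hT0, ← Real.mul_rpow (by positivity) hlog]
    congr 1; ring
  have e2 : max ((T : ℝ) ^ m)
      ((T : ℝ) * L ^ (1 / (α + 1)) * ((T : ℝ) ^ m) ^ (-(α / (α + 1))))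
      ≤ (1 + L ^ (1 / (α + 1))) * (T : ℝ) ^ rate m α := by
    have hr0 : 0 < (T : ℝ) ^ rate m α := by positivity
    refine max_le ?_ ?_
    · have : (T : ℝ) ^ m ≤ (T : ℝ) ^ rate m α :=
        Real.rpow_le_rpow_of_exponent_le hT1 (le_max_left _ _)
      nlinarith
    · have h1 : (T : ℝ) * ((T : ℝ) ^ m) ^ (-(α / (α + 1))) ≤ (T : ℝ) ^ rate m α := by
        rw [← Real.rpow_mul hT0.le]
        calc (T : ℝ) * (T : ℝ) ^ (m * -(α / (α + 1)))
            = (T : ℝ) ^ (1 - m * (α / (α + 1))) := by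
              rw [sub_eq_add_neg, Real.rpow_add hT0, Real.rpow_one]
              congr 2; ring
          _ ≤ _ := Real.rpow_le_rpow_of_exponent_le hT1 (le_max_right _ _)
      calc _ = L ^ (1 / (α + 1)) * ((T : ℝ) * ((T : ℝ) ^ m) ^ (-(α / (α + 1)))) := by ring
        _ ≤ L ^ (1 / (α + 1)) * (T : ℝ) ^ rate m α := by gcongr
        _ ≤ _ := by nlinarith
  rw [Real.norm_of_nonneg (by rw [e1]; positivity), Real.norm_of_nonneg (by positivity), e1]
  calc _ ≤ 4000 * ((m / Real.log 2) ^ (3 / 2 : ℝ) * (Real.log T) ^ (3 / 2 : ℝ))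
        * ((1 + L ^ (1 / (α + 1))) * (T : ℝ) ^ rate m α) := by gcongr
    _ = _ := by ring

end Doubling

end MeDZO

theorem corollary1 (m : ℝ) (hm : m ∈ Set.Icc (1 / 2 : ℝ) 1)
    (ν₀ : MeasureTheory.Measure unitInterval) [MeasureTheory.IsProbabilityMeasure ν₀]
    (α L : ℝ) (hα : 0 < α) (hL : 0 < L) :
    (∀ T : ℕ, 2 ≤ T → ∀ E : MeDZO.Environment, E.f ∈ MeDZO.holderClass L α →
      MeDZO.regret m ν₀ E T ≤
        4000 * (Real.logb 2 ((T : ℝ) ^ m)) ^ (3 / 2 : ℝ) *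
          max ((T : ℝ) ^ m)
            ((T : ℝ) * L ^ (1 / (α + 1)) * ((T : ℝ) ^ m) ^ (-(α / (α + 1))))) ∧
    (fun T : ℕ =>
        4000 * (Real.logb 2 ((T : ℝ) ^ m)) ^ (3 / 2 : ℝ) *
          max ((T : ℝ) ^ m)
            ((T : ℝ) * L ^ (1 / (α + 1)) * ((T : ℝ) ^ m) ^ (-(α / (α + 1)))))
      =O[Filter.atTop]
        (fun T : ℕ => (Real.log (T : ℝ)) ^ (3 / 2 : ℝ) * (T : ℝ) ^ MeDZO.rate m α) :=
  ⟨fun _ hT E hf => MeDZO.regret_le hm ν₀ hα hL hT E hf,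
    MeDZO.isBigO_bound (by linarith [hm.1]) hL⟩
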